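/- Let $n\ge 2$ and $s\in(0,1]$. For $h\in C_c^\infty(\mathbb R^n)$ put $$(-\Delta)^s h(x)=c_{s,n}\,\mathrm{p.v.}\!\int_{\mathbb R^n}\frac{h(x)-h(y)}{|x-y|^{n+2s}}\,dy\quad(0<s<1),\qquad (-\Delta)^1h=-\Delta h,$$ with the normalization constant $c_{s,n}=\frac{s\,4^s\,\Gamma(n/2+s)}{\pi^{n/2}\Gamma(1-s)}>0$. For $u:\mathbb R^n\to[-\infty,\infty)$ with $$\int_{\mathbb R^n}\frac{|u(x)|}{(1+|x|^2)^{\frac{n+2s}{2}}}\,dx<\infty \tag{1}$$ the distribution $(-\Delta)^su$ is defined by $\langle(-\Delta)^su,h\rangle=\int_{\mathbb R^n}u\,(-\Delta)^sh\,dx$ for $h\in C_c^\infty(\mathbb R^n)$. An upper semicontinuous function $u:\mathbb R^n\to[-\infty,\infty)$ with (1) and with $u(x)=\operatorname{ess\,lim\,sup}_{y\to x}u(y)$ for every $x\in\mathbb R^n$ (which holds automatically if $u$ is continuous) is called $s$-subharmonic in $\mathbb R^n$ if $-(-\Delta)^su\ge0$ in $\mathcal D'(\mathbb R^n)$, and $s$-harmonic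 in $\mathbb R^n$ if in addition $-(-\Delta)^su\le0$ in $\mathcal D'(\mathbb R^n)$. A function is radial if $u(x)$ depends only on $|x|$. Maxima and minima are absolute ones. **Theorem (maximum principle).** A radial $s$-subharmonic function in $\mathbb R^n$ is either constant or does not attain a maximum in $\mathbb R^n$. **Corollaries.** 1. A radial $s$-harmonic function is either constant or attains neither a maximum nor a minimum in $\mathbb R^n$. 2. If $u_1,u_2$ are radial $s$-harmonic functions with $u_1\ge u_2$ in $\mathbb R^n$, then either $u_1>u_2$ everywhere or $u_1\equiv u_2$. 3. If $u$ is a continuous radial $s$-harmonic function with $u(x)\to0$ as $|x|\to\infty$, then $u\equiv0$. 4. If $u_1,u_2:\mathbb R^n\to\mathbb R$ are continuous radial functions with (1), $(-\Delta)^su_1=(-\Delta)^su_2$ in $\mathcal D'(\mathbb R^n)$ and $u_1(x)-u_2(x)\to0$ as $|x|\to\infty$, then $u_1\equiv u_2$. -/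

import Mathlib

open MeasureTheory Filter Topology
open scoped ContDiff

noncomputable section

namespace FracSub

/-- A function on `ℝⁿ` is radial if its value depends only on `|x|`. -/
def IsRadial {n : ℕ} {α : Type*} (u : EuclideanSpace ℝ (Fin n) → α) : Prop :=
  ∀ x y, ‖x‖ = ‖y‖ → u x = u y

/-- The normalization constant `c_{s,n} = s 4^s Γ(n/2 + s) / (π^{n/2} Γ(1 - s))` of the fractional
Laplacian. It is positive for `0 < s < 1`. -/
def normConst (n : ℕ) (s : ℝ) : ℝ :=
  s * (4 : ℝ) ^ s * Real.Gamma ((n : ℝ) / 2 + s) /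
    (Real.pi ^ ((n : ℝ) / 2) * Real.Gamma (1 - s))

/-- The fractional Laplacian `(-Δ)^s h (x)` for `s ∈ (0, 1]`, used on test functions `h` only: the
principal value integral `c_{s,n} lim_{ε → 0+} ∫_{|x - y| > ε} (h x - h y) / |x - y|^{n + 2 s} dy`
when `s < 1`, and `-Δ h (x)` when `s = 1`. The limit exists for every `h ∈ C_c^∞`. -/
def fracLaplacian {n : ℕ} (s : ℝ) (h : EuclideanSpace ℝ (Fin n) → ℝ)
    (x : EuclideanSpace ℝ (Fin n)) : ℝ :=
  if s = 1 then -(Laplacian.laplacian h x)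
  else normConst n s *
    limUnder (𝓝[>] (0 : ℝ)) (fun ε : ℝ =>
      ∫ y in (Metric.closedBall x ε)ᶜ, (h x - h y) / ‖x - y‖ ^ ((n : ℝ) + 2 * s))

/-- Real test functions on `ℝⁿ`: smooth with compact support. -/
def IsTestFunction {n : ℕ} (h : EuclideanSpace ℝ (Fin n) → ℝ) : Prop :=
  ContDiff ℝ ∞ h ∧ HasCompactSupport h

/-- The weighted integrability condition `∫ |u(x)| (1 + |x|²)^{-(n + 2 s)/2} dx < ∞`, where
`|-∞| = ∞`, so that `u` is finite almost everywhere. -/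
def WeightedIntegrable {n : ℕ} (s : ℝ) (u : EuclideanSpace ℝ (Fin n) → EReal) : Prop :=
  (∫⁻ x, (u x).abs / ENNReal.ofReal ((1 + ‖x‖ ^ 2) ^ (((n : ℝ) + 2 * s) / 2))) < ⊤

/-- The distribution `(-Δ)^s u`, applied to a test function `h`: `∫ u (-Δ)^s h dx`. (It is used for
functions `u` that are finite almost everywhere.) -/
def fracLaplacianDistrib {n : ℕ} (s : ℝ) (u : EuclideanSpace ℝ (Fin n) → EReal)
    (h : EuclideanSpace ℝ (Fin n) → ℝ) : ℝ :=
  ∫ x, (u x).toReal * fracLaplacian s h x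

/-- The standing class of functions `u : ℝⁿ → [-∞, ∞)`: upper semicontinuous, with the weighted
integrability condition, and equal at *every* point to the essential upper limit. The last clause
fixes the values on null sets, which the distribution `(-Δ)^s u` does not see; every continuous
function satisfies it. -/
structure IsAdmissible {n : ℕ} (s : ℝ) (u : EuclideanSpace ℝ (Fin n) → EReal) : Prop where
  lt_top : ∀ x, u x < ⊤
  usc : UpperSemicontinuous u
  integrable : WeightedIntegrable s u
  precise : ∀ x, u x = limsup u (𝓝 x ⊓ ae volume)

/-- `u` is `s`-subharmonic in `ℝⁿ`: `-(-Δ)^s u ≥ 0` in `D'(ℝⁿ)`. -/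
def IsSSubharmonic {n : ℕ} (s : ℝ) (u : EuclideanSpace ℝ (Fin n) → EReal) : Prop :=
  IsAdmissible s u ∧
    ∀ h : EuclideanSpace ℝ (Fin n) → ℝ, IsTestFunction h → (∀ x, 0 ≤ h x) →
      0 ≤ -fracLaplacianDistrib s u h

/-- `u` is `s`-harmonic in `ℝⁿ`: it is `s`-subharmonic and also `-(-Δ)^s u ≤ 0` in `D'(ℝⁿ)`. -/
def IsSHarmonic {n : ℕ} (s : ℝ) (u : EuclideanSpace ℝ (Fin n) → EReal) : Prop :=
  IsSSubharmonic s u ∧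
    ∀ h : EuclideanSpace ℝ (Fin n) → ℝ, IsTestFunction h → (∀ x, 0 ≤ h x) →
      -fracLaplacianDistrib s u h ≤ 0

/-- `u` realizes an absolute maximum in `ℝⁿ`. -/
def AttainsMax {n : ℕ} (u : EuclideanSpace ℝ (Fin n) → EReal) : Prop :=
  ∃ x₀, ∀ x, u x ≤ u x₀

/-- `u` realizes an absolute minimum in `ℝⁿ`. -/
def AttainsMin {n : ℕ} (u : EuclideanSpace ℝ (Fin n) → EReal) : Prop :=
  ∃ x₀, ∀ x, u x₀ ≤ u x

/-- `u` is constant. -/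
def IsConst {n : ℕ} (u : EuclideanSpace ℝ (Fin n) → EReal) : Prop :=
  ∃ c, ∀ x, u x = c

end FracSub

end

noncomputable section

namespace FracSub

variable {n : ℕ}

local notation "𝔼" => EuclideanSpace ℝ (Fin n)

/-! Let φ be the radially decreasing `bump`, g = (-Δ)^s φ, and G(y) = ∫₀¹ σ^{n-1} g(σy) dσ its
`segmentMean`. The dilate l^n G(ly) equals ∫₀^l σ^{n-1} g(σy) dσ, so the l-derivative of the kernel
mean ∫ u(y) l^n G(l(x-y)) dy is l^{n-1} ∫ u(y) g(l(x-y)) dy. By scaling this is l^{n-1-2s} times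
(-Δ)^s u tested on φ(l(x-·)), which is nonpositive for subharmonic u. Kernel means thus decrease in
l (`IsMeanGenerator.kernelMean_le`). As l → ∞ they converge weakly to m u with m = ∫ G > 0, so m u
is a.e. at most every kernel mean (`IsMeanGenerator.ae_le_kernelMean`). The bound holds at every
point, because u is its own essential upper limit.

This needs G ≥ 0 and the decay of the weight, although g changes sign when s < 1. Since g is radial,
|y|^n G(y) is a positive multiple of ∫ g over the ball of radius |y|. For s < 1, Fubini turns that
integral into c ∫ D(z) |z|^{-n-2s} dz, where D(z) is the mass the ball loses when φ is translated by
z. Monotonicity of φ gives D ≥ 0 (`massDefect_nonneg`), and D = 0 for small z gives the decay. For s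
= 1 the segment mean is explicit (`segmentMean_neg_laplacian_bump`).

If u has maximum M at x₀, then mM ≤ kernel mean at x₀ ≤ mM, so u = M a.e. where the kernel is
positive, in particular on the punctured ball of radius 1/l; let l → 0
(`IsMeanGenerator.ae_eq_of_le_kernelMean`). For harmonic u both inequalities hold, so u is
continuous with an exact mean value property. That property passes to -u and to differences, which
yields the corollaries. -/

/-- The weight `(1 + |x|²)^{-a/2}`. -/
def weight (a : ℝ) (x : 𝔼) : ℝ := (1 + ‖x‖ ^ 2) ^ (-a / 2)

/-! ### The weight under translation and dilation -/

section Weight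

variable {a : ℝ}

theorem weight_pos (x : 𝔼) : 0 < weight a x := by
  unfold weight; positivity

theorem continuous_weight : Continuous (weight a : 𝔼 → ℝ) := by
  unfold weight
  refine Continuous.rpow_const (by fun_prop) fun x => Or.inl ?_
  positivity

theorem integrable_weight (ha : (n : ℝ) < a) : Integrable (weight a : 𝔼 → ℝ) := by
  unfold weight
  exact integrable_rpow_neg_one_add_norm_sq (by simpa using ha)

/-- If `1 + |x|² ≤ c (1 + |y|²)`, then the weight at `y` is at most `c^{a/2}` times that at `x`. -/
theorem weight_le_of_le (ha : 0 ≤ a) {c : ℝ} (hc : 0 < c) {x y : 𝔼}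
    (h : 1 + ‖x‖ ^ 2 ≤ c * (1 + ‖y‖ ^ 2)) : weight a y ≤ c ^ (a / 2) * weight a x := by
  have hx : 0 < 1 + ‖x‖ ^ 2 := by positivity
  have hy : 0 < 1 + ‖y‖ ^ 2 := by positivity
  have h1 := Real.rpow_le_rpow hx.le h (div_nonneg ha zero_le_two)
  rw [Real.mul_rpow hc.le hy.le] at h1
  unfold weight
  rw [neg_div, Real.rpow_neg hx.le, Real.rpow_neg hy.le, ← div_eq_mul_inv,
    le_div_iff₀ (by positivity), mul_comm, ← div_eq_mul_inv, div_le_iff₀ (by positivity)]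
  exact h1

/-- Peetre's inequality: `1 + |y|² ≤ 2 (1 + |x|²) (1 + |x - y|²)`. -/
theorem weight_sub_le (ha : 0 ≤ a) (x y : 𝔼) :
    weight a (x - y) ≤ (2 * (1 + ‖x‖ ^ 2)) ^ (a / 2) * weight a y := by
  refine weight_le_of_le ha (by positivity) ?_
  have h1 : ‖y‖ ≤ ‖x‖ + ‖x - y‖ := by
    have := norm_sub_le x (x - y); simpa using this
  have h2 : ‖y‖ ^ 2 ≤ (‖x‖ + ‖x - y‖) ^ 2 := by gcongr
  nlinarith [sq_nonneg (‖x‖ - ‖x - y‖), mul_nonneg (sq_nonneg ‖x‖) (sq_nonneg ‖x - y‖)]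

theorem weight_smul_le (ha : 0 ≤ a) {σ : ℝ} (hσ : 0 < σ) (y : 𝔼) :
    weight a (σ • y) ≤ (1 + (σ⁻¹) ^ 2) ^ (a / 2) * weight a y := by
  refine weight_le_of_le ha (by positivity) ?_
  rw [norm_smul, mul_pow, Real.norm_eq_abs, sq_abs]
  have : (σ⁻¹) ^ 2 * (σ ^ 2 * ‖y‖ ^ 2) = ‖y‖ ^ 2 := by field_simp
  nlinarith [sq_nonneg (σ * ‖y‖), sq_nonneg (σ⁻¹)]

/-- The constant is uniform in `σ ≥ l` and in `x` in a ball; this supplies the majorants for Fubini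
and dominated convergence. -/
theorem weight_smul_sub_le (ha : 0 ≤ a) {l σ : ℝ} (hl : 0 < l) (hσ : l ≤ σ) {R : ℝ} {x : 𝔼}
    (hx : ‖x‖ ≤ R) (y : 𝔼) :
    weight a (σ • (x - y)) ≤
      (1 + (l⁻¹) ^ 2) ^ (a / 2) * (2 * (1 + R ^ 2)) ^ (a / 2) * weight a y := by
  have hσ0 : 0 < σ := hl.trans_le hσ
  refine (weight_smul_le ha hσ0 _).trans ?_
  rw [mul_assoc]
  have h1 : σ⁻¹ ≤ l⁻¹ := inv_anti₀ hl hσ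
  have h0 : 0 ≤ σ⁻¹ := (inv_pos.2 hσ0).le
  have hw : 0 < weight a y := weight_pos y
  refine mul_le_mul ?_ ((weight_sub_le ha x y).trans ?_) (weight_pos _).le (by positivity)
  · exact Real.rpow_le_rpow (by positivity) (by gcongr) (by positivity)
  · refine mul_le_mul_of_nonneg_right ?_ hw.le
    exact Real.rpow_le_rpow (by positivity) (by gcongr) (by positivity)

/-- Dilation by a factor `≥ 1` with preserved mass does not enlarge the weight away from `0`. -/
theorem pow_mul_weight_smul_le (ha : (n : ℝ) ≤ a) {l : ℝ} (hl : 1 ≤ l) {x : 𝔼} (hx : 1 ≤ ‖x‖) :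
    l ^ n * weight a (l • x) ≤ 2 ^ (a / 2) * weight a x := by
  have ha0 : 0 ≤ a := (Nat.cast_nonneg n).trans ha
  have hl0 : 0 < l := by linarith
  have h1 : weight a (l • x) ≤ (2 * (l⁻¹) ^ 2) ^ (a / 2) * weight a x := by
    refine weight_le_of_le ha0 (by positivity) ?_
    rw [norm_smul, mul_pow, Real.norm_eq_abs, sq_abs]
    have : (l⁻¹) ^ 2 * (l ^ 2 * ‖x‖ ^ 2) = ‖x‖ ^ 2 := by field_simp
    nlinarith [sq_nonneg (l⁻¹)]
  have h2 : (2 * (l⁻¹) ^ 2) ^ (a / 2) = 2 ^ (a / 2) * l ^ (-a) := by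
    rw [Real.mul_rpow (by positivity) (by positivity), ← Real.rpow_natCast, ← Real.rpow_mul
      (by positivity), Real.inv_rpow hl0.le, ← Real.rpow_neg hl0.le]
    congr 2; push_cast; ring
  -- The factor `l ^ n` of the mass-preserving dilation is absorbed because `a ≥ n`.
  have h3 : l ^ n * l ^ (-a) ≤ 1 := by
    rw [← Real.rpow_natCast, ← Real.rpow_add hl0]
    exact Real.rpow_le_one_of_one_le_of_nonpos hl (by linarith)
  calc l ^ n * weight a (l • x) ≤ l ^ n * ((2 * (l⁻¹) ^ 2) ^ (a / 2) * weight a x) := by gcongr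
    _ = (l ^ n * l ^ (-a)) * (2 ^ (a / 2) * weight a x) := by rw [h2]; ring
    _ ≤ 1 * (2 ^ (a / 2) * weight a x) := by
        have := weight_pos (a := a) x
        gcongr
    _ = _ := one_mul _

theorem integrable_of_le_weight (ha : (n : ℝ) < a) {f : 𝔼 → ℝ} (hf : Continuous f) {C : ℝ}
    (hC : ∀ x, |f x| ≤ C * weight a x) : Integrable f :=
  ((integrable_weight ha).const_mul C).mono' hf.aestronglyMeasurable (.of_forall hC)

end Weight

/-! ### Segment means and the kernels they generate -/

/-- The average `∫₀¹ σ^{n-1} g(σ y) dσ` of `g` along the segment from `0` to `y`. -/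
def segmentMean (g : 𝔼 → ℝ) (y : 𝔼) : ℝ := ∫ σ in (0 : ℝ)..1, σ ^ (n - 1) * g (σ • y)

theorem continuous_segmentMean {g : 𝔼 → ℝ} (hg : Continuous g) : Continuous (segmentMean g) := by
  unfold segmentMean
  exact intervalIntegral.continuous_parametric_intervalIntegral_of_continuous' (by fun_prop) _ _

/-- The dilates of the segment mean, as integrals. -/
theorem pow_mul_segmentMean_smul (hn : n ≠ 0) (g : 𝔼 → ℝ) (l : ℝ) (y : 𝔼) :
    l ^ n * segmentMean g (l • y) = ∫ σ in (0 : ℝ)..l, σ ^ (n - 1) * g (σ • y) := by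
  have h := intervalIntegral.mul_integral_comp_mul_left (a := 0) (b := 1) (c := l)
    (f := fun σ => σ ^ (n - 1) * g (σ • y))
  simp only [mul_zero, mul_one] at h
  rw [← h, segmentMean]
  obtain ⟨k, rfl⟩ := Nat.exists_eq_succ_of_ne_zero hn
  rw [← intervalIntegral.integral_const_mul, ← intervalIntegral.integral_const_mul]
  congr 1; ext σ
  simp only [Nat.succ_eq_add_one, Nat.add_sub_cancel, smul_smul, mul_pow, mul_comm σ l]
  ring

/-- A generator of mean value kernels: a function `g` whose segment mean is a nonnegative kernel,
positive in the punctured unit ball, both of them dominated by the weight. -/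
structure IsMeanGenerator (a : ℝ) (g : 𝔼 → ℝ) : Prop where
  continuous : Continuous g
  abs_le : ∃ C, ∀ x, |g x| ≤ C * weight a x
  mean_nonneg : ∀ x, 0 ≤ segmentMean g x
  mean_le : ∃ C, ∀ x, segmentMean g x ≤ C * weight a x
  mean_pos : ∀ x, x ≠ 0 → ‖x‖ < 1 → 0 < segmentMean g x

/-- The dilated kernel mean of `u` at scale `1 / l`. -/
def kernelMean (g u : 𝔼 → ℝ) (l : ℝ) (x : 𝔼) : ℝ :=
  ∫ y, u y * (l ^ n * segmentMean g (l • (x - y)))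

/-! ### Integrability against the weight -/

section Mean

variable {a : ℝ} {g u : EuclideanSpace ℝ (Fin n) → ℝ}

theorem integrable_mul_of_le_weight (hu : Integrable fun x => u x * weight a x)
    {k : 𝔼 → ℝ} (hk : AEStronglyMeasurable k) {C : ℝ} (hC : ∀ x, |k x| ≤ C * weight a x) :
    Integrable fun x => u x * k x := by
  have h : Integrable fun x => (u x * weight a x) * (k x / weight a x) := by
    have hk' : AEStronglyMeasurable fun x => k x / weight a x := by
      simp only [div_eq_mul_inv]
      exact hk.mul (continuous_weight.inv₀ fun x => (weight_pos x).ne').aestronglyMeasurable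
    refine hu.mul_bdd (c := C) hk' (.of_forall fun x => ?_)
    rw [Real.norm_eq_abs, abs_div, abs_of_pos (weight_pos x), div_le_iff₀ (weight_pos x)]
    exact hC x
  refine h.congr (.of_forall fun x => ?_)
  have := (weight_pos (a := a) x).ne'
  field_simp

theorem aestronglyMeasurable_of_mul_weight (hu : Integrable fun x => u x * weight a x) :
    AEStronglyMeasurable u := by
  have h : AEStronglyMeasurable fun x => (u x * weight a x) * (weight a x)⁻¹ :=
    hu.aestronglyMeasurable.mul
      (continuous_weight.inv₀ fun x => (weight_pos x).ne').aestronglyMeasurable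
  refine h.congr (.of_forall fun x => ?_)
  have := (weight_pos (a := a) x).ne'
  simp [this]

theorem locallyIntegrable_of_mul_weight (hu : Integrable fun x => u x * weight a x) :
    LocallyIntegrable u := by
  have h2 : LocallyIntegrable fun x => (u x * weight a x) * (weight a x)⁻¹ := by
    rw [← locallyIntegrableOn_univ]
    exact (hu.locallyIntegrable.locallyIntegrableOn _).mul_continuousOn
      ((continuous_weight.inv₀ fun x => (weight_pos x).ne').continuousOn)
      isClosed_univ.isLocallyClosed
  refine h2.congr (.of_forall fun x => ?_)
  have := (weight_pos (a := a) x).ne'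
  simp [this]

end Mean

/-! ### Monotonicity of kernel means and the sub-mean-value inequality -/

section MeanInequality

variable {a : ℝ} {g u : EuclideanSpace ℝ (Fin n) → ℝ}

theorem IsMeanGenerator.integrable_segmentMean (hg : IsMeanGenerator a g) (ha : (n : ℝ) < a) :
    Integrable (segmentMean g) := by
  obtain ⟨C, hC⟩ := hg.mean_le
  exact integrable_of_le_weight ha (continuous_segmentMean hg.continuous) fun x => by
    rw [abs_of_nonneg (hg.mean_nonneg x)]; exact hC x

/-- Uniform domination of the kernels on bounded sets of centres. -/
theorem exists_abs_comp_smul_sub_le (ha : 0 ≤ a) {k : 𝔼 → ℝ}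
    (hk : ∃ C, ∀ x, |k x| ≤ C * weight a x) {l : ℝ} (hl : 0 < l) (R : ℝ) :
    ∃ C, 0 ≤ C ∧ ∀ σ, l ≤ σ → ∀ x, ‖x‖ ≤ R → ∀ y, |k (σ • (x - y))| ≤ C * weight a y := by
  obtain ⟨C, hC⟩ := hk
  refine ⟨|C| * ((1 + (l⁻¹) ^ 2) ^ (a / 2) * (2 * (1 + R ^ 2)) ^ (a / 2)), by positivity,
    fun σ hσ x hx y => ?_⟩
  calc |k (σ • (x - y))| ≤ C * weight a (σ • (x - y)) := hC _
    _ ≤ |C| * weight a (σ • (x - y)) :=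
        mul_le_mul_of_nonneg_right (le_abs_self C) (weight_pos _).le
    _ ≤ |C| * ((1 + (l⁻¹) ^ 2) ^ (a / 2) * (2 * (1 + R ^ 2)) ^ (a / 2) * weight a y) :=
        mul_le_mul_of_nonneg_left (weight_smul_sub_le ha hl hσ hx y) (abs_nonneg _)
    _ = _ := by ring

theorem integrable_mul_comp_smul_sub (ha : 0 ≤ a) {k : 𝔼 → ℝ} (hkc : Continuous k)
    (hk : ∃ C, ∀ x, |k x| ≤ C * weight a x) (hu : Integrable fun x => u x * weight a x)
    {l : ℝ} (hl : 0 < l) (x : 𝔼) : Integrable fun y => u y * k (l • (x - y)) := by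
  obtain ⟨C, -, hC⟩ := exists_abs_comp_smul_sub_le ha hk hl ‖x‖
  exact integrable_mul_of_le_weight hu (by fun_prop) (hC l le_rfl x le_rfl)

theorem IsMeanGenerator.abs_mean_le (hg : IsMeanGenerator a g) :
    ∃ C, ∀ x, |segmentMean g x| ≤ C * weight a x := by
  obtain ⟨C, hC⟩ := hg.mean_le
  exact ⟨C, fun x => by rw [abs_of_nonneg (hg.mean_nonneg x)]; exact hC x⟩

theorem IsMeanGenerator.integrable_mul_kernel (hg : IsMeanGenerator a g) (ha : 0 ≤ a)
    (hu : Integrable fun x => u x * weight a x) {l : ℝ} (hl : 0 < l) (x : 𝔼) :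
    Integrable fun y => u y * (l ^ n * segmentMean g (l • (x - y))) := by
  have h := (integrable_mul_comp_smul_sub ha (continuous_segmentMean hg.continuous)
    hg.abs_mean_le hu hl x).const_mul (l ^ n)
  refine h.congr (.of_forall fun y => ?_)
  ring

/-- The dilated kernel is a primitive in the scale, by `pow_mul_segmentMean_smul`, so Fubini
expresses the change of the mean through pairings of `u` with dilates of `g`. -/
theorem IsMeanGenerator.kernelMean_sub (hg : IsMeanGenerator a g) (ha : 0 ≤ a) (hn : n ≠ 0)
    (hu : Integrable fun x => u x * weight a x) {l m : ℝ} (hl : 0 < l) (hlm : l ≤ m) (x : 𝔼) :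
    kernelMean g u m x - kernelMean g u l x =
      ∫ σ in l..m, σ ^ (n - 1) * ∫ y, u y * g (σ • (x - y)) := by
  have hgc := hg.continuous
  have hm : 0 < m := hl.trans_le hlm
  rw [kernelMean, kernelMean, ← integral_sub (hg.integrable_mul_kernel ha hu hm x)
    (hg.integrable_mul_kernel ha hu hl x)]
  have hint : ∀ y, u y * (m ^ n * segmentMean g (m • (x - y))) -
      u y * (l ^ n * segmentMean g (l • (x - y))) =
      ∫ σ in l..m, u y * (σ ^ (n - 1) * g (σ • (x - y))) := by
    intro y
    have hi : ∀ b c : ℝ, IntervalIntegrable (fun σ : ℝ => σ ^ (n - 1) * g (σ • (x - y)))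
        volume b c := fun b c => Continuous.intervalIntegrable (by fun_prop) _ _
    rw [pow_mul_segmentMean_smul hn, pow_mul_segmentMean_smul hn, ← mul_sub,
      intervalIntegral.integral_interval_sub_left (hi _ _) (hi _ _),
      intervalIntegral.integral_const_mul]
  simp only [hint]
  rw [← intervalIntegral_integral_swap]
  · refine intervalIntegral.integral_congr fun σ _ => ?_
    rw [← integral_const_mul]
    congr 1; ext y; ring
  · obtain ⟨C, hC0, hC⟩ := exists_abs_comp_smul_sub_le ha hg.abs_le hl ‖x‖
    have hfin : IsFiniteMeasure ((volume : Measure ℝ).restrict (Set.uIoc l m)) := by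
      rw [Set.uIoc_of_le hlm]; infer_instance
    have h1 : Integrable (fun p : ℝ × 𝔼 => u p.2 * weight a p.2)
        (((volume : Measure ℝ).restrict (Set.uIoc l m)).prod volume) := hu.comp_snd _
    have h2 := h1.norm.const_mul (m ^ (n - 1) * C)
    refine h2.mono' ?_ ?_
    · have h3 : AEStronglyMeasurable (fun p : ℝ × 𝔼 => u p.2)
          (((volume : Measure ℝ).restrict (Set.uIoc l m)).prod volume) :=
        (aestronglyMeasurable_of_mul_weight hu).comp_snd
      exact h3.mul (Continuous.aestronglyMeasurable (by fun_prop))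
    · have h4 : ∀ᵐ p : ℝ × 𝔼 ∂(((volume : Measure ℝ).restrict (Set.uIoc l m)).prod volume),
          p.1 ∈ Set.uIoc l m :=
        Measure.quasiMeasurePreserving_fst.ae (ae_restrict_mem measurableSet_uIoc)
      filter_upwards [h4] with p hp
      rw [Set.uIoc_of_le hlm] at hp
      have hp0 : 0 < p.1 := hl.trans hp.1
      have h5 := hC p.1 hp.1.le x le_rfl p.2
      have hw := weight_pos (a := a) p.2
      simp only [Function.uncurry, Real.norm_eq_abs, abs_mul, abs_of_pos hw,
        abs_of_pos (pow_pos hp0 _)]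
      calc |u p.2| * (p.1 ^ (n - 1) * |g (p.1 • (x - p.2))|)
          ≤ |u p.2| * (m ^ (n - 1) * (C * weight a p.2)) := by
            gcongr
            exact hp.2
        _ = _ := by ring

/-- For `g = (-Δ)^s bump`, the hypothesis `hsub` is subharmonicity tested on the bumps `bump (σ • (x
- ·))`, up to the factor `σ ^ (2 * s)`. -/
theorem IsMeanGenerator.kernelMean_le (hg : IsMeanGenerator a g) (ha : 0 ≤ a) (hn : n ≠ 0)
    (hu : Integrable fun x => u x * weight a x)
    (hsub : ∀ x, ∀ σ : ℝ, 0 < σ → ∫ y, u y * g (σ • (x - y)) ≤ 0)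
    {l m : ℝ} (hl : 0 < l) (hlm : l ≤ m) (x : 𝔼) : kernelMean g u m x ≤ kernelMean g u l x := by
  rw [← sub_nonpos, hg.kernelMean_sub ha hn hu hl hlm]
  have h := intervalIntegral.integral_nonneg (μ := volume)
    (f := fun σ => -(σ ^ (n - 1) * ∫ y, u y * g (σ • (x - y)))) hlm fun σ hσ => by
      have hσ0 : 0 < σ := hl.trans_le hσ.1
      have := mul_nonneg (pow_pos hσ0 (n - 1)).le (neg_nonneg.2 (hsub x σ hσ0))
      linarith
  rw [intervalIntegral.integral_neg] at h
  linarith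

theorem IsMeanGenerator.continuous_kernelMean (hg : IsMeanGenerator a g) (ha : 0 ≤ a)
    (hu : Integrable fun x => u x * weight a x) {l : ℝ} (hl : 0 < l) :
    Continuous (kernelMean g u l) := by
  have hc := continuous_segmentMean hg.continuous
  refine continuous_iff_continuousAt.2 fun x₀ => ?_
  obtain ⟨C, hC0, hC⟩ := exists_abs_comp_smul_sub_le ha hg.abs_mean_le hl (‖x₀‖ + 1)
  refine continuousAt_of_dominated (bound := fun y => l ^ n * C * |u y * weight a y|) ?_ ?_
    (hu.norm.const_mul _) (.of_forall fun y => by fun_prop)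
  · exact .of_forall fun x => (hg.integrable_mul_kernel ha hu hl x).aestronglyMeasurable
  · filter_upwards [Metric.ball_mem_nhds x₀ one_pos] with x hx
    refine .of_forall fun y => ?_
    have hx' : ‖x‖ ≤ ‖x₀‖ + 1 := by
      have h1 := norm_add_le x₀ (x - x₀)
      rw [add_sub_cancel] at h1
      rw [mem_ball_iff_norm] at hx
      linarith
    have h5 := hC l le_rfl x hx' y
    have hw := weight_pos (a := a) y
    simp only [Real.norm_eq_abs, abs_mul, abs_of_pos hw, abs_of_pos (pow_pos hl n)]
    calc |u y| * (l ^ n * |segmentMean g (l • (x - y))|)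
        ≤ |u y| * (l ^ n * (C * weight a y)) := by gcongr
      _ = _ := by ring

/-- Fubini moves the averaging from `u`, which is merely integrable, to the continuous `ψ`, where
the limit of small scales can be taken. -/
theorem IsMeanGenerator.integral_mul_kernelMean (hg : IsMeanGenerator a g) (ha : 0 ≤ a)
    (hu : Integrable fun x => u x * weight a x) {l : ℝ} (hl : 0 < l)
    {ψ : 𝔼 → ℝ} (hψ : Continuous ψ) (hψs : HasCompactSupport ψ) :
    ∫ x, ψ x * kernelMean g u l x =
      ∫ y, u y * ∫ x, ψ x * (l ^ n * segmentMean g (l • (x - y))) := by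
  have hc := continuous_segmentMean hg.continuous
  obtain ⟨R, hR⟩ := hψs.isBounded.exists_norm_le
  obtain ⟨C, hC0, hC⟩ := exists_abs_comp_smul_sub_le ha hg.abs_mean_le hl R
  have h : Integrable (Function.uncurry fun x y : 𝔼 =>
      ψ x * (u y * (l ^ n * segmentMean g (l • (x - y)))))
      ((volume : Measure 𝔼).prod volume) := by
    have h1 := (hψ.integrable_of_hasCompactSupport (μ := volume) hψs).mul_prod hu
    refine (h1.norm.const_mul (l ^ n * C)).mono' ?_ (.of_forall fun p => ?_)
    · have h3 : AEStronglyMeasurable (fun p : 𝔼 × 𝔼 => u p.2)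
          ((volume : Measure 𝔼).prod volume) := (aestronglyMeasurable_of_mul_weight hu).comp_snd
      have h4 : AEStronglyMeasurable (fun p : 𝔼 × 𝔼 => ψ p.1)
          ((volume : Measure 𝔼).prod volume) :=
        Continuous.aestronglyMeasurable (by fun_prop)
      exact h4.mul (h3.mul (Continuous.aestronglyMeasurable (by fun_prop)))
    · have hw := weight_pos (a := a) p.2
      simp only [Function.uncurry, Real.norm_eq_abs, abs_mul, abs_of_pos hw,
        abs_of_pos (pow_pos hl n)]
      by_cases hp : ψ p.1 = 0
      · simp [hp]
      · have h5 := hC l le_rfl p.1 (hR _ (subset_tsupport _ hp)) p.2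
        calc |ψ p.1| * (|u p.2| * (l ^ n * |segmentMean g (l • (p.1 - p.2))|))
            ≤ |ψ p.1| * (|u p.2| * (l ^ n * (C * weight a p.2))) := by gcongr
          _ = _ := by ring
  calc ∫ x, ψ x * kernelMean g u l x
      = ∫ x, ∫ y, ψ x * (u y * (l ^ n * segmentMean g (l • (x - y)))) := by
        simp only [kernelMean, ← integral_const_mul]
    _ = ∫ y, ∫ x, ψ x * (u y * (l ^ n * segmentMean g (l • (x - y)))) :=
        integral_integral_swap h
    _ = _ := by
        congr 1; ext y
        rw [← integral_const_mul]
        congr 1; ext x; ring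

/-- Mollification at scale `1 / l`, written as an average over the kernel. -/
theorem integral_mul_dilate_eq (k ψ : 𝔼 → ℝ) {l : ℝ} (hl : 0 < l) (y : 𝔼) :
    ∫ x, ψ x * (l ^ n * k (l • (x - y))) = ∫ z, ψ (y + l⁻¹ • z) * k z := by
  have h1 : ∫ x, ψ x * (l ^ n * k (l • (x - y))) = ∫ x, ψ (x + y) * (l ^ n * k (l • x)) := by
    rw [← integral_add_right_eq_self _ y]
    simp
  have h2 := Measure.integral_comp_smul (volume : Measure 𝔼)
    (fun z => ψ (y + l⁻¹ • z) * k z) l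
  simp only [smul_smul, inv_mul_cancel₀ hl.ne', one_smul, finrank_euclideanSpace, Fintype.card_fin,
    abs_of_pos (inv_pos.2 (pow_pos hl n)), smul_eq_mul] at h2
  rw [h1]
  calc ∫ x, ψ (x + y) * (l ^ n * k (l • x)) = l ^ n * ∫ x, ψ (y + x) * k (l • x) := by
        rw [← integral_const_mul]
        congr 1; ext x; rw [add_comm]; ring
    _ = _ := by rw [h2, ← mul_assoc, mul_inv_cancel₀ (pow_pos hl n).ne', one_mul]

theorem IsMeanGenerator.tendsto_integral_mul_dilate (hg : IsMeanGenerator a g)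
    (ha : (n : ℝ) < a) {ψ : 𝔼 → ℝ} (hψ : Continuous ψ) (hψs : HasCompactSupport ψ) (y : 𝔼) :
    Tendsto (fun l : ℝ => ∫ x, ψ x * (l ^ n * segmentMean g (l • (x - y)))) atTop
      (𝓝 (ψ y * ∫ z, segmentMean g z)) := by
  have hc := continuous_segmentMean hg.continuous
  obtain ⟨B, hB⟩ := hψ.bounded_above_of_compact_support hψs
  have h : Tendsto (fun l : ℝ => ∫ z, ψ (y + l⁻¹ • z) * segmentMean g z) atTop
      (𝓝 (∫ z, ψ y * segmentMean g z)) := by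
    refine tendsto_integral_filter_of_dominated_convergence (fun z => B * |segmentMean g z|)
      (.of_forall fun l => Continuous.aestronglyMeasurable (by fun_prop)) ?_
      ((hg.integrable_segmentMean ha).norm.const_mul B) (.of_forall fun z => ?_)
    · refine .of_forall fun l => .of_forall fun z => ?_
      rw [norm_mul]
      exact mul_le_mul_of_nonneg_right (hB _) (norm_nonneg _)
    · have h1 : Tendsto (fun l : ℝ => y + l⁻¹ • z) atTop (𝓝 (y + (0 : ℝ) • z)) :=
        tendsto_const_nhds.add (tendsto_inv_atTop_zero.smul_const z)
      rw [zero_smul, add_zero] at h1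
      exact ((hψ.tendsto y).comp h1).mul_const _
  rw [integral_const_mul] at h
  refine h.congr' ?_
  filter_upwards [eventually_gt_atTop 0] with l hl
  exact (integral_mul_dilate_eq (segmentMean g) ψ hl y).symm

/-- Near the support of `ψ` the bound is sup |ψ| times the kernel mass, which does not depend on
`l`. At distance at least 1 from the support, a mass-preserving dilation with `l ≥ 1` does not
enlarge the weight by more than a constant. -/
theorem IsMeanGenerator.exists_abs_integral_mul_dilate_le (hg : IsMeanGenerator a g)
    (ha : (n : ℝ) < a) {ψ : 𝔼 → ℝ} (hψ : Continuous ψ) (hψs : HasCompactSupport ψ) :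
    ∃ C, ∀ l : ℝ, 1 ≤ l → ∀ y,
      |∫ x, ψ x * (l ^ n * segmentMean g (l • (x - y)))| ≤ C * weight a y := by
  have ha0 : 0 ≤ a := (Nat.cast_nonneg n).trans ha.le
  have hc := continuous_segmentMean hg.continuous
  obtain ⟨B, hB⟩ := hψ.bounded_above_of_compact_support hψs
  obtain ⟨R, hR⟩ := hψs.isBounded.exists_norm_le
  obtain ⟨K, hK⟩ := hg.mean_le
  have hψi : Integrable ψ := hψ.integrable_of_hasCompactSupport hψs
  have hB0 : 0 ≤ B := (norm_nonneg _).trans (hB 0)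
  have hK0 : 0 ≤ K := by
    have h1 := (hg.mean_nonneg 0).trans (hK 0)
    exact nonneg_of_mul_nonneg_left h1 (weight_pos 0)
  set m := ∫ z, segmentMean g z with hm
  have hm0 : 0 ≤ m := integral_nonneg hg.mean_nonneg
  set C₁ := B * m * (1 + (|R| + 1) ^ 2) ^ (a / 2) with hC₁
  set C₂ := (∫ x, |ψ x|) * (K * 2 ^ (a / 2) * (2 * (1 + R ^ 2)) ^ (a / 2)) with hC₂
  have hi0 : 0 ≤ ∫ x, |ψ x| := integral_nonneg fun x => abs_nonneg _
  have hC₁0 : 0 ≤ C₁ := by positivity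
  have hC₂0 : 0 ≤ C₂ := by positivity
  refine ⟨C₁ + C₂, fun l hl y => ?_⟩
  have hl0 : 0 < l := by linarith
  have hw := weight_pos (a := a) y
  by_cases hy : ‖y‖ ≤ |R| + 1
  · have h1 : |∫ x, ψ x * (l ^ n * segmentMean g (l • (x - y)))| ≤ B * m := by
      rw [integral_mul_dilate_eq _ _ hl0, hm, ← integral_const_mul, ← Real.norm_eq_abs]
      refine norm_integral_le_of_norm_le ((hg.integrable_segmentMean ha).const_mul B)
        (.of_forall fun z => ?_)
      rw [norm_mul, Real.norm_of_nonneg (hg.mean_nonneg z)]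
      exact mul_le_mul_of_nonneg_right (hB _) (hg.mean_nonneg z)
    have h2 : 1 ≤ (1 + (|R| + 1) ^ 2) ^ (a / 2) * weight a y := by
      have h3 := weight_le_of_le (n := n) ha0 (c := 1 + (|R| + 1) ^ 2) (by positivity)
        (x := y) (y := 0) (by simp only [norm_zero]; nlinarith [norm_nonneg y])
      simpa [weight] using h3
    calc _ ≤ B * m * 1 := by rw [mul_one]; exact h1
      _ ≤ B * m * ((1 + (|R| + 1) ^ 2) ^ (a / 2) * weight a y) := by gcongr
      _ = C₁ * weight a y := by rw [hC₁]; ring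
      _ ≤ _ := by nlinarith
  · push Not at hy
    have h1 : |∫ x, ψ x * (l ^ n * segmentMean g (l • (x - y)))| ≤
        ∫ x, |ψ x| * (K * 2 ^ (a / 2) * (2 * (1 + R ^ 2)) ^ (a / 2) * weight a y) := by
      rw [← Real.norm_eq_abs]
      refine norm_integral_le_of_norm_le (hψi.norm.mul_const _) (.of_forall fun x => ?_)
      rw [norm_mul, Real.norm_eq_abs]
      by_cases hx : ψ x = 0
      · simp [hx]
      · have hxR := hR x (subset_tsupport _ hx)
        have hxy : 1 ≤ ‖x - y‖ := by
          have h4 := norm_sub_norm_le y x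
          rw [norm_sub_rev] at h4
          linarith [le_abs_self R]
        have hs := hg.mean_nonneg (l • (x - y))
        rw [Real.norm_of_nonneg (by positivity)]
        refine mul_le_mul_of_nonneg_left ?_ (abs_nonneg _)
        calc l ^ n * segmentMean g (l • (x - y)) ≤ l ^ n * (K * weight a (l • (x - y))) := by
              gcongr; exact hK _
          _ = K * (l ^ n * weight a (l • (x - y))) := by ring
          _ ≤ K * (2 ^ (a / 2) * weight a (x - y)) := by
              exact mul_le_mul_of_nonneg_left (pow_mul_weight_smul_le ha.le hl hxy) hK0
          _ ≤ K * (2 ^ (a / 2) * ((2 * (1 + ‖x‖ ^ 2)) ^ (a / 2) * weight a y)) := by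
              gcongr; exact weight_sub_le ha0 x y
          _ ≤ K * (2 ^ (a / 2) * ((2 * (1 + R ^ 2)) ^ (a / 2) * weight a y)) := by
              gcongr
          _ = _ := by ring
    rw [integral_mul_const] at h1
    calc _ ≤ _ := h1
      _ = C₂ * weight a y := by rw [hC₂]; ring
      _ ≤ _ := by nlinarith

/-- The kernel means converge weakly to a multiple of the function as the scale shrinks. -/
theorem IsMeanGenerator.tendsto_integral_mul_kernelMean (hg : IsMeanGenerator a g)
    (ha : (n : ℝ) < a) (hu : Integrable fun x => u x * weight a x)
    {ψ : 𝔼 → ℝ} (hψ : Continuous ψ) (hψs : HasCompactSupport ψ) :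
    Tendsto (fun l : ℝ => ∫ x, ψ x * kernelMean g u l x) atTop
      (𝓝 (∫ y, u y * (ψ y * ∫ z, segmentMean g z))) := by
  have ha0 : 0 ≤ a := (Nat.cast_nonneg n).trans ha.le
  have hc := continuous_segmentMean hg.continuous
  obtain ⟨C, hC⟩ := hg.exists_abs_integral_mul_dilate_le ha hψ hψs
  have h : Tendsto (fun l : ℝ => ∫ y, u y * ∫ x, ψ x * (l ^ n * segmentMean g (l • (x - y))))
      atTop (𝓝 (∫ y, u y * (ψ y * ∫ z, segmentMean g z))) := by
    refine tendsto_integral_filter_of_dominated_convergence (fun y => C * |u y * weight a y|)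
      (.of_forall fun l => ?_) ?_ (hu.norm.const_mul C) (.of_forall fun y => ?_)
    · refine (aestronglyMeasurable_of_mul_weight hu).mul ?_
      have h1 : StronglyMeasurable (Function.uncurry fun y x : 𝔼 =>
          ψ x * (l ^ n * segmentMean g (l • (x - y)))) :=
        Continuous.stronglyMeasurable (by unfold Function.uncurry; fun_prop)
      exact h1.integral_prod_right.aestronglyMeasurable
    · filter_upwards [eventually_ge_atTop 1] with l hl
      refine .of_forall fun y => ?_
      rw [norm_mul, Real.norm_eq_abs, Real.norm_eq_abs, abs_mul, abs_of_pos (weight_pos y)]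
      calc _ ≤ |u y| * (C * weight a y) := mul_le_mul_of_nonneg_left (hC l hl y) (abs_nonneg _)
        _ = _ := by ring
    · exact (hg.tendsto_integral_mul_dilate ha hψ hψs y).const_mul (u y)
  refine h.congr' ?_
  filter_upwards [eventually_gt_atTop 0] with l hl
  exact (hg.integral_mul_kernelMean ha0 hu hl hψ hψs).symm

/-- A locally integrable function that is nonnegative as a distribution is nonnegative a.e. -/
theorem ae_nonneg_of_forall_integral_mul_nonneg {f : 𝔼 → ℝ} (hf : LocallyIntegrable f)
    (h : ∀ ψ : 𝔼 → ℝ, Continuous ψ → HasCompactSupport ψ → (∀ x, 0 ≤ ψ x) → 0 ≤ ∫ x, ψ x * f x) :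
    ∀ᵐ x, 0 ≤ f x := by
  have hpos : ∀ k : ℕ, (0 : ℝ) < 1 / ((k : ℝ) + 1) := fun k => by positivity
  let φ : ℕ → ContDiffBump (0 : 𝔼) := fun k =>
    ⟨1 / ((k : ℝ) + 1), 2 * (1 / ((k : ℝ) + 1)), hpos k, by linarith [hpos k]⟩
  have hφ : Tendsto (fun k => (φ k).rOut) atTop (𝓝 0) := by
    have h0 := (tendsto_one_div_add_atTop_nhds_zero_nat (𝕜 := ℝ)).const_mul (2 : ℝ)
    rwa [mul_zero] at h0
  -- At almost every point `f` is the limit of its averages against shrinking bumps, each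
  -- nonnegative by `h`. The factor 2 is the bounded ratio of outer to inner radius.
  have h1 := ContDiffBump.ae_convolution_tendsto_right_of_locallyIntegrable (μ := volume)
    (K := 2) hφ (.of_forall fun k => le_rfl) hf
  filter_upwards [h1] with x hx
  refine ge_of_tendsto' hx fun k => ?_
  rw [convolution_eq_swap]
  simp only [ContinuousLinearMap.lsmul_apply, smul_eq_mul]
  refine h _ ?_ ?_ fun y => (φ k).nonneg_normed _
  · exact (φ k).continuous_normed.comp (continuous_const.sub continuous_id)
  · exact (φ k).hasCompactSupport_normed.comp_homeomorph (Homeomorph.subLeft x)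

/-- The mean at any `l' ≥ l` is at most the mean at `l`. Letting `l' → ∞` weakly gives the
inequality as distributions, hence almost everywhere. -/
theorem IsMeanGenerator.ae_le_kernelMean (hg : IsMeanGenerator a g) (ha : (n : ℝ) < a)
    (hn : n ≠ 0) (hu : Integrable fun x => u x * weight a x)
    (hsub : ∀ x, ∀ σ : ℝ, 0 < σ → ∫ y, u y * g (σ • (x - y)) ≤ 0) {l : ℝ} (hl : 0 < l) :
    ∀ᵐ x, (∫ z, segmentMean g z) * u x ≤ kernelMean g u l x := by
  have ha0 : 0 ≤ a := (Nat.cast_nonneg n).trans ha.le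
  have hcont := hg.continuous_kernelMean ha0 hu hl
  set m := ∫ z, segmentMean g z
  have hul : LocallyIntegrable u := locallyIntegrable_of_mul_weight hu
  have h := ae_nonneg_of_forall_integral_mul_nonneg
    (f := fun x => kernelMean g u l x - m * u x)
    (hcont.locallyIntegrable.sub (hul.smul m)) fun ψ hψ hψs hψ0 => by
      have h1 := hg.tendsto_integral_mul_kernelMean ha hu hψ hψs
      have h2 : ∫ y, u y * (ψ y * m) ≤ ∫ x, ψ x * kernelMean g u l x := by
        refine le_of_tendsto h1 ?_
        filter_upwards [eventually_ge_atTop l] with l' hl'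
        refine integral_mono ?_ ?_ fun x => ?_
        · exact Continuous.integrable_of_hasCompactSupport
            (hψ.mul (hg.continuous_kernelMean ha0 hu (hl.trans_le hl'))) hψs.mul_right
        · exact Continuous.integrable_of_hasCompactSupport (hψ.mul hcont) hψs.mul_right
        · exact mul_le_mul_of_nonneg_left (hg.kernelMean_le ha0 hn hu hsub hl hl' x) (hψ0 x)
      have h3 : Integrable fun x => ψ x * u x := by
        simpa using hul.integrable_smul_left_of_hasCompactSupport hψ hψs
      have h4 : ∫ x, ψ x * (kernelMean g u l x - m * u x) =
          (∫ x, ψ x * kernelMean g u l x) - ∫ y, u y * (ψ y * m) := by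
        rw [← integral_sub]
        · congr 1; ext x; ring
        · exact Continuous.integrable_of_hasCompactSupport (hψ.mul hcont) hψs.mul_right
        · refine (h3.mul_const m).congr (.of_forall fun x => ?_)
          ring
      rw [h4]; linarith
  filter_upwards [h] with x hx
  linarith

theorem IsMeanGenerator.integral_pos (hg : IsMeanGenerator a g) (ha : (n : ℝ) < a)
    (hn : n ≠ 0) : 0 < ∫ z, segmentMean g z := by
  have : NeZero n := ⟨hn⟩
  have hc := continuous_segmentMean hg.continuous
  obtain ⟨v, hv⟩ := exists_norm_eq 𝔼 (c := 1 / 2) (by norm_num)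
  have hv0 : v ≠ 0 := by rintro rfl; norm_num at hv
  exact integral_pos_of_integrable_nonneg_nonzero hc (hg.integrable_segmentMean ha)
    hg.mean_nonneg (hg.mean_pos v hv0 (by rw [hv]; norm_num)).ne'

/-- If the kernel means at `x₀` do not fall below an essential upper bound, it is attained a.e. -/
theorem IsMeanGenerator.ae_eq_of_le_kernelMean (hg : IsMeanGenerator a g) (ha : (n : ℝ) < a)
    (hn : n ≠ 0) (hu : Integrable fun x => u x * weight a x) {M : ℝ} (hM : ∀ᵐ x, u x ≤ M) {x₀ : 𝔼}
    (h : ∀ l : ℝ, 0 < l → (∫ z, segmentMean g z) * M ≤ kernelMean g u l x₀) : ∀ᵐ x, u x = M := by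
  have : NeZero n := ⟨hn⟩
  have ha0 : 0 ≤ a := (Nat.cast_nonneg n).trans ha.le
  have hw := integrable_weight (n := n) ha
  have hMi : Integrable fun x : 𝔼 => M * weight a x := hw.const_mul M
  have key : ∀ k : ℕ, ∀ᵐ x, x ≠ x₀ → ‖x₀ - x‖ < k + 1 → u x = M := by
    intro k
    -- At this scale the kernel is positive on the punctured ball of radius `k + 1` about `x₀`;
    -- countably many such balls cover the rest of the space.
    set l : ℝ := 1 / ((k : ℝ) + 1) with hl_def
    have hl : 0 < l := by positivity
    have h1 : ∫ y, M * (l ^ n * segmentMean g (l • (x₀ - y))) = M * ∫ z, segmentMean g z := by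
      rw [integral_const_mul]
      have h2 := integral_mul_dilate_eq (n := n) (fun z => segmentMean g (-z)) (fun _ => 1) hl x₀
      simp only [one_mul, ← smul_neg, neg_sub] at h2
      rw [h2, integral_neg_eq_self (fun z => segmentMean g z)]
    have i1 := hg.integrable_mul_kernel (u := fun _ => M) ha0 hMi hl x₀
    have i2 := hg.integrable_mul_kernel ha0 hu hl x₀
    have h3 : 0 ≤ᵐ[volume] fun y => M * (l ^ n * segmentMean g (l • (x₀ - y))) -
        u y * (l ^ n * segmentMean g (l • (x₀ - y))) := by
      filter_upwards [hM] with y hy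
      have := mul_nonneg (sub_nonneg.2 hy)
        (mul_nonneg (pow_pos hl n).le (hg.mean_nonneg (l • (x₀ - y))))
      simp only [Pi.zero_apply]
      linarith
    -- The integrand is a.e. nonnegative, while `h` makes its integral nonpositive; it therefore
    -- vanishes a.e., and where the kernel is positive this means `u = M`.
    have h4 : ∫ y, (M * (l ^ n * segmentMean g (l • (x₀ - y))) -
        u y * (l ^ n * segmentMean g (l • (x₀ - y)))) = 0 := by
      refine le_antisymm ?_ (integral_nonneg_of_ae h3)
      rw [integral_sub i1 i2, h1]
      have := h l hl
      rw [kernelMean] at this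
      linarith
    rw [integral_eq_zero_iff_of_nonneg_ae h3 (i1.sub i2)] at h4
    filter_upwards [h4] with x hx hne hlt
    have hpos : 0 < l ^ n * segmentMean g (l • (x₀ - x)) := by
      refine mul_pos (pow_pos hl n) (hg.mean_pos _ ?_ ?_)
      · exact smul_ne_zero hl.ne' (sub_ne_zero.2 hne.symm)
      · rw [norm_smul, Real.norm_of_nonneg hl.le, hl_def, one_div, inv_mul_lt_iff₀ (by positivity)]
        linarith
    simp only [Pi.zero_apply, ← sub_mul] at hx
    rcases mul_eq_zero.1 hx with h | h
    · linarith
    · exact absurd h hpos.ne'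
  have h0 : ∀ᵐ x : 𝔼, x ≠ x₀ := by
    have : Nontrivial 𝔼 := inferInstance
    exact Measure.ae_ne volume x₀
  filter_upwards [ae_all_iff.2 key, h0] with x hx hne
  obtain ⟨k, hk⟩ := exists_nat_gt ‖x₀ - x‖
  exact hx k hne (by linarith)

end MeanInequality

/-! ### The fractional Laplacian of test functions through second differences -/

section SecondDifference

variable {a s : ℝ} {h : EuclideanSpace ℝ (Fin n) → ℝ}

/-- The symmetric second difference `2 h(x) - h(x + z) - h(x - z)`. -/
def secondDiff (h : 𝔼 → ℝ) (x z : 𝔼) : ℝ := 2 * h x - h (x + z) - h (x - z)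

/-- The integrable majorant `min(|z|², 1) / |z|^a` of the singular integrals. -/
def singularWeight (a : ℝ) (z : 𝔼) : ℝ := min (‖z‖ ^ 2) 1 / ‖z‖ ^ a

theorem singularWeight_nonneg (z : 𝔼) : 0 ≤ singularWeight a z := by
  unfold singularWeight; positivity

/-- In polar coordinates the integrand is `r ^ (n + 1 - a)` near 0 and `r ^ (n - 1 - a)` at
infinity; the two bounds on `a` are the two convergence conditions. -/
theorem integrable_singularWeight (hn : n ≠ 0) (ha : (n : ℝ) < a) (ha' : a < n + 2) :
    Integrable (singularWeight a : 𝔼 → ℝ) := by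
  have : NeZero n := ⟨hn⟩
  have hn1 : ((n - 1 : ℕ) : ℝ) = (n : ℝ) - 1 := by
    rw [Nat.cast_sub (Nat.one_le_iff_ne_zero.2 hn), Nat.cast_one]
  unfold singularWeight
  refine (integrable_fun_norm_addHaar (E := 𝔼) volume (f := fun r => min (r ^ 2) 1 / r ^ a)).2 ?_
  rw [← Set.Ioc_union_Ioi_eq_Ioi zero_le_one]
  simp only [finrank_euclideanSpace, Fintype.card_fin, smul_eq_mul]
  refine IntegrableOn.union ?_ ?_
  · have h1 := (intervalIntegral.intervalIntegrable_rpow' (a := 0) (b := 1)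
      (r := (n : ℝ) + 1 - a) (by linarith)).1
    refine h1.congr_fun (fun r hr => ?_) measurableSet_Ioc
    have hr0 : 0 < r := hr.1
    simp only
    rw [min_eq_left (by nlinarith [hr.2]), ← Real.rpow_natCast, hn1, ← Real.rpow_two,
      mul_div_assoc', ← Real.rpow_add hr0, ← Real.rpow_sub hr0]
    congr 1; ring
  · have h1 := integrableOn_Ioi_rpow_of_lt (a := (n : ℝ) - 1 - a) (by linarith) one_pos
    refine h1.congr_fun (fun r hr => ?_) measurableSet_Ioi
    have hr1 : 1 < r := hr
    have hr0 : 0 < r := by linarith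
    simp only
    rw [min_eq_right (by nlinarith), ← Real.rpow_natCast, hn1, mul_one_div, ← Real.rpow_sub hr0]

/-- The quadratic bound is the mean value inequality for `w ↦ h w - h (w - z)`, whose derivative is
at most `L |z|` because `fderiv h` is Lipschitz. The bound for large `z` uses only sup |h|. -/
theorem IsTestFunction.exists_abs_secondDiff_le (hh : IsTestFunction h) :
    ∃ C, 0 ≤ C ∧ ∀ x z, |secondDiff h x z| ≤ C * min (‖z‖ ^ 2) 1 := by
  obtain ⟨hc, hs⟩ := hh
  obtain ⟨B, hB⟩ := hc.continuous.bounded_above_of_compact_support hs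
  have hB0 : 0 ≤ B := (norm_nonneg _).trans (hB 0)
  have hd : Differentiable ℝ h := hc.differentiable (by simp)
  obtain ⟨L, hL⟩ := ContDiff.lipschitzWith_of_hasCompactSupport (hs.fderiv (𝕜 := ℝ))
    (hc.fderiv_right (m := 1) (WithTop.coe_le_coe.2 le_top)) one_ne_zero
  refine ⟨max L (4 * B), by positivity, fun x z => ?_⟩
  rw [mul_min_of_nonneg _ _ (by positivity), le_min_iff]
  constructor
  · have hφd : ∀ w, HasFDerivAt (fun w => h w - h (w - z)) (fderiv ℝ h w - fderiv ℝ h (w - z)) w :=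
      fun w => by
        have h1 := (hd (w - z)).hasFDerivAt.comp w ((hasFDerivAt_id w).sub_const z)
        exact (hd w).hasFDerivAt.sub h1
    have h2 := convex_univ.norm_image_sub_le_of_norm_hasFDerivWithin_le
      (fun w _ => (hφd w).hasFDerivWithinAt) (C := L * ‖z‖) (fun w _ => by
        have := hL.dist_le_mul w (w - z)
        rwa [dist_eq_norm, dist_eq_norm, sub_sub_cancel] at this)
      (Set.mem_univ x) (Set.mem_univ (x + z))
    simp only [add_sub_cancel_right, add_sub_cancel_left] at h2
    calc |secondDiff h x z| = ‖h (x + z) - h x - (h x - h (x - z))‖ := by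
          rw [Real.norm_eq_abs, ← abs_neg, secondDiff]; congr 1; ring
      _ ≤ L * ‖z‖ * ‖z‖ := h2
      _ = L * ‖z‖ ^ 2 := by ring
      _ ≤ _ := by gcongr; exact le_max_left _ _
  · have h1 := hB x
    have h2 := hB (x + z)
    have h3 := hB (x - z)
    rw [Real.norm_eq_abs, abs_le] at h1 h2 h3
    rw [mul_one]
    refine le_trans ?_ (le_max_right _ _)
    rw [secondDiff, abs_le]
    constructor <;> linarith

theorem IsTestFunction.abs_secondDiff_div_le {C : ℝ} {x z : 𝔼}
    (hC : |secondDiff h x z| ≤ C * min (‖z‖ ^ 2) 1) :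
    ‖secondDiff h x z / ‖z‖ ^ a‖ ≤ C * singularWeight a z := by
  rw [Real.norm_eq_abs, abs_div, abs_of_nonneg (by positivity : 0 ≤ ‖z‖ ^ a), singularWeight,
    ← mul_div_assoc]
  exact div_le_div_of_nonneg_right hC (by positivity)

theorem measurable_secondDiff_div (hh : Continuous h) :
    Measurable fun p : 𝔼 × 𝔼 => secondDiff h p.1 p.2 / ‖p.2‖ ^ a := by
  have h1 : Continuous fun p : 𝔼 × 𝔼 => secondDiff h p.1 p.2 := by
    unfold secondDiff; fun_prop
  exact h1.measurable.div (by fun_prop)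

/-- The principal value integral as an absolutely convergent one. -/
theorem IsTestFunction.fracLaplacian_eq (hh : IsTestFunction h) (hn : n ≠ 0) (hs₀ : 0 < s)
    (hs₁ : s < 1) (x : 𝔼) : fracLaplacian s h x =
      normConst n s * (1 / 2 * ∫ z, secondDiff h x z / ‖z‖ ^ ((n : ℝ) + 2 * s)) := by
  have hκ := integrable_singularWeight (n := n) (a := (n : ℝ) + 2 * s) hn (by linarith)
    (by linarith)
  set a := (n : ℝ) + 2 * s with ha
  obtain ⟨C, hC0, hC⟩ := hh.exists_abs_secondDiff_le
  obtain ⟨B, hB⟩ := hh.1.continuous.bounded_above_of_compact_support hh.2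
  have hB0 : 0 ≤ B := (norm_nonneg _).trans (hB 0)
  have hhc := hh.1.continuous
  rw [fracLaplacian, if_neg hs₁.ne, ← ha]
  congr 1
  apply Tendsto.limUnder_eq
  set f : ℝ → 𝔼 → ℝ := fun ε => {z : 𝔼 | ε < ‖z‖}.indicator
    (fun z => (h x - h (x + z)) / ‖z‖ ^ a) with hf
  have hms : ∀ ε : ℝ, MeasurableSet {z : 𝔼 | ε < ‖z‖} := fun ε =>
    measurableSet_lt measurable_const measurable_norm
  have hfi : ∀ ε > 0, Integrable (f ε) := by
    intro ε hε
    have hm : 0 < min (ε ^ 2) 1 := by positivity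
    refine (hκ.const_mul (2 * B / min (ε ^ 2) 1)).mono' ?_ (.of_forall fun z => ?_)
    · refine (Measurable.indicator ?_ (hms ε)).aestronglyMeasurable
      exact Measurable.div (Continuous.measurable (by fun_prop)) (by fun_prop)
    · by_cases hz : ε < ‖z‖
      · have hz' : z ∈ {z : 𝔼 | ε < ‖z‖} := hz
        rw [hf]
        simp only [Set.indicator_of_mem hz']
        rw [Real.norm_eq_abs, abs_div, abs_of_nonneg (by positivity : 0 ≤ ‖z‖ ^ a),
          singularWeight, ← mul_div_assoc]
        refine div_le_div_of_nonneg_right ?_ (by positivity)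
        have h1 : |h x - h (x + z)| ≤ 2 * B := by
          have := abs_sub (h x) (h (x + z))
          have h2 := hB x; have h3 := hB (x + z)
          rw [Real.norm_eq_abs] at h2 h3
          linarith
        have h2 : min (ε ^ 2) 1 ≤ min (‖z‖ ^ 2) 1 := min_le_min_right _ (by gcongr)
        calc |h x - h (x + z)| ≤ 2 * B / min (ε ^ 2) 1 * min (ε ^ 2) 1 := by
              rw [div_mul_cancel₀ _ hm.ne']; exact h1
          _ ≤ _ := by gcongr
      · have hz' : z ∉ {z : 𝔼 | ε < ‖z‖} := hz
        rw [hf]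
        simp only [Set.indicator_of_notMem hz', norm_zero]
        exact mul_nonneg (by positivity) (singularWeight_nonneg z)
  -- The truncated domain is invariant under `z ↦ -z`, so the first difference may be replaced by
  -- half the second difference; the limit in `ε` is then dominated.
  have hsymm : ∀ ε > 0, (∫ y in (Metric.closedBall x ε)ᶜ, (h x - h y) / ‖x - y‖ ^ a) =
      1 / 2 * ∫ z, {z : 𝔼 | ε < ‖z‖}.indicator (fun z => secondDiff h x z / ‖z‖ ^ a) z := by
    intro ε hε
    have h1 : (∫ y in (Metric.closedBall x ε)ᶜ, (h x - h y) / ‖x - y‖ ^ a) = ∫ z, f ε z := by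
      rw [← integral_indicator Metric.isClosed_closedBall.measurableSet.compl,
        ← integral_add_left_eq_self _ x]
      congr 1; ext z
      by_cases hz : ε < ‖z‖ <;> simp [hf, Set.indicator, hz]
    have h2 : ∫ z, f ε (-z) = ∫ z, f ε z := integral_neg_eq_self _ _
    have h3 : ∫ z, {z : 𝔼 | ε < ‖z‖}.indicator (fun z => secondDiff h x z / ‖z‖ ^ a) z =
        (∫ z, f ε z) + ∫ z, f ε (-z) := by
      rw [← integral_add (hfi ε hε) (hfi ε hε).comp_neg]
      congr 1; ext z
      by_cases hz : ε < ‖z‖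
      · simp only [hf, Set.indicator, Set.mem_ofPred_eq, hz, norm_neg, if_true, secondDiff]
        rw [← sub_eq_add_neg]
        ring
      · simp [hf, Set.indicator, hz]
    rw [h1, h3, h2]; ring
  have hlim : Tendsto (fun ε : ℝ => ∫ z, {z : 𝔼 | ε < ‖z‖}.indicator
      (fun z => secondDiff h x z / ‖z‖ ^ a) z) (𝓝[>] 0)
      (𝓝 (∫ z, secondDiff h x z / ‖z‖ ^ a)) := by
    have hmeas : Measurable fun z : 𝔼 => secondDiff h x z / ‖z‖ ^ a :=
      (measurable_secondDiff_div hhc).comp (measurable_const.prodMk measurable_id)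
    refine tendsto_integral_filter_of_dominated_convergence (fun z => C * singularWeight a z)
      (.of_forall fun ε => (hmeas.indicator (hms ε)).aestronglyMeasurable)
      (.of_forall fun ε => .of_forall fun z => ?_) (hκ.const_mul C) (.of_forall fun z => ?_)
    · exact (norm_indicator_le_norm_self _ _).trans (abs_secondDiff_div_le (hC x z))
    · by_cases hz : z = 0
      · refine tendsto_const_nhds.congr fun ε => ?_
        simp [hz, secondDiff, Set.indicator, two_mul]
      · refine tendsto_const_nhds.congr' ?_
        have hz' : (0 : ℝ) < ‖z‖ := norm_pos_iff.2 hz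
        filter_upwards [mem_nhdsWithin_of_mem_nhds (Iio_mem_nhds hz')] with ε hε
        rw [Set.indicator_of_mem]
        exact hε
  refine (hlim.const_mul (1 / 2)).congr' ?_
  filter_upwards [self_mem_nhdsWithin] with ε hε
  exact (hsymm ε hε).symm

theorem IsTestFunction.continuous_fracLaplacian (hh : IsTestFunction h) (hn : n ≠ 0)
    (hs₀ : 0 < s) (hs₁ : s < 1) : Continuous (fracLaplacian s h) := by
  have hκ := integrable_singularWeight (n := n) (a := (n : ℝ) + 2 * s) hn (by linarith)
    (by linarith)
  obtain ⟨C, hC0, hC⟩ := hh.exists_abs_secondDiff_le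
  have hhc := hh.1.continuous
  rw [funext (hh.fracLaplacian_eq hn hs₀ hs₁)]
  refine continuous_const.mul (continuous_const.mul ?_)
  refine continuous_of_dominated (bound := fun z => C * singularWeight ((n : ℝ) + 2 * s) z)
    (fun x => ?_) (fun x => .of_forall fun z => abs_secondDiff_div_le (hC x z))
    (hκ.const_mul C) (.of_forall fun z => ?_)
  · exact ((measurable_secondDiff_div hhc).comp
      (measurable_const.prodMk measurable_id)).aestronglyMeasurable
  · unfold secondDiff; fun_prop

theorem IsTestFunction.comp_smul_sub (hh : IsTestFunction h) {σ : ℝ} (hσ : 0 < σ) (x : 𝔼) :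
    IsTestFunction fun y => h (σ • (x - y)) := by
  refine ⟨hh.1.comp (by fun_prop), ?_⟩
  exact hh.2.comp_homeomorph ((Homeomorph.subLeft x).trans (Homeomorph.smulOfNeZero σ hσ.ne'))

/-- Substituting `σ • z`, the singular kernel contributes `σ ^ (n + 2 * s)` and the Jacobian `σ ^
(-n)`. The reflection in `x - y` is harmless because second differences are even in `z`. -/
theorem IsTestFunction.fracLaplacian_comp_smul_sub_of_lt (hh : IsTestFunction h) (hn : n ≠ 0)
    (hs₀ : 0 < s) (hs₁ : s < 1) {σ : ℝ} (hσ : 0 < σ) (x y : 𝔼) :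
    fracLaplacian s (fun y => h (σ • (x - y))) y =
      σ ^ (2 * s) * fracLaplacian s h (σ • (x - y)) := by
  rw [(hh.comp_smul_sub hσ x).fracLaplacian_eq hn hs₀ hs₁, hh.fracLaplacian_eq hn hs₀ hs₁]
  set a := (n : ℝ) + 2 * s with ha
  have h1 := Measure.integral_comp_smul (volume : Measure 𝔼)
    (fun w => secondDiff h (σ • (x - y)) w / ‖w‖ ^ a) σ
  simp only [finrank_euclideanSpace, Fintype.card_fin,
    abs_of_pos (inv_pos.2 (pow_pos hσ n)), smul_eq_mul] at h1
  have h2 : ∫ z, secondDiff (fun y => h (σ • (x - y))) y z / ‖z‖ ^ a =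
      σ ^ a * ∫ z, secondDiff h (σ • (x - y)) (σ • z) / ‖σ • z‖ ^ a := by
    rw [← integral_const_mul]
    congr 1; ext z
    have h3 : secondDiff (fun y => h (σ • (x - y))) y z =
        secondDiff h (σ • (x - y)) (σ • z) := by
      simp only [secondDiff, ← smul_add, ← smul_sub]
      rw [show x - (y + z) = x - y - z by abel, show x - (y - z) = x - y + z by abel]
      ring
    rw [h3, norm_smul, Real.norm_of_nonneg hσ.le, Real.mul_rpow hσ.le (norm_nonneg _)]
    have : 0 < σ ^ a := by positivity
    rw [mul_div_assoc', mul_div_mul_left _ _ this.ne']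
  have h4 : σ ^ a = σ ^ n * σ ^ (2 * s) := by
    rw [ha, Real.rpow_add hσ, Real.rpow_natCast]
  rw [h2, h1, h4]
  have : σ ^ n ≠ 0 := (pow_pos hσ n).ne'
  field_simp

theorem IsTestFunction.isRadial_fracLaplacian (hh : IsTestFunction h) (hn : n ≠ 0)
    (hs₀ : 0 < s) (hs₁ : s < 1) (hr : IsRadial h) : IsRadial (fracLaplacian s h) := by
  intro x y hxy
  rw [hh.fracLaplacian_eq hn hs₀ hs₁, hh.fracLaplacian_eq hn hs₀ hs₁]
  congr 2
  -- For `|x| = |y|`, the reflection in the hyperplane orthogonal to `x - y` is an isometry carrying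
  -- `x` to `y`.
  let A : 𝔼 ≃ₗᵢ[ℝ] 𝔼 := (Submodule.span ℝ {x - y})ᗮ.reflection
  have hA : A x = y := Submodule.reflection_sub hxy
  rw [← A.measurePreserving.integral_comp A.toHomeomorph.measurableEmbedding
    fun z => secondDiff h y z / ‖z‖ ^ ((n : ℝ) + 2 * s)]
  congr 1; ext z
  rw [A.norm_map, ← hA]
  congr 1
  simp only [secondDiff, ← map_add, ← map_sub]
  rw [hr (A x) x (A.norm_map _), hr (A (x + z)) (x + z) (A.norm_map _),
    hr (A (x - z)) (x - z) (A.norm_map _)]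

end SecondDifference

/-! ### The bump and the mass it loses under translation -/

/-- The smooth radially decreasing bump `exp(-1 / (1 - |x|²))` of the unit ball. -/
def bump (x : 𝔼) : ℝ := expNegInvGlue (1 - ‖x‖ ^ 2)

theorem bump_nonneg (x : 𝔼) : 0 ≤ bump x := expNegInvGlue.nonneg _

theorem bump_eq_zero {x : 𝔼} (hx : 1 ≤ ‖x‖) : bump x = 0 :=
  expNegInvGlue.zero_of_nonpos (by nlinarith)

theorem bump_pos {x : 𝔼} (hx : ‖x‖ < 1) : 0 < bump x :=
  expNegInvGlue.pos_of_pos (by nlinarith [norm_nonneg x])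

theorem bump_neg (x : 𝔼) : bump (-x) = bump x := by simp [bump]

theorem isRadial_bump : IsRadial (bump : 𝔼 → ℝ) := fun x y h => by simp [bump, h]

theorem isTestFunction_bump : IsTestFunction (bump : 𝔼 → ℝ) := by
  refine ⟨?_, ?_⟩
  · have h : ContDiff ℝ ∞ expNegInvGlue := expNegInvGlue.contDiff
    exact h.comp (contDiff_const.sub (contDiff_norm_sq ℝ))
  · refine HasCompactSupport.intro (isCompact_closedBall (0 : 𝔼) 1) fun x hx => ?_
    rw [mem_closedBall_zero_iff, not_le] at hx
    exact bump_eq_zero hx.le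

theorem continuous_bump : Continuous (bump : 𝔼 → ℝ) := isTestFunction_bump.1.continuous

theorem integrable_bump : Integrable (bump : 𝔼 → ℝ) :=
  continuous_bump.integrable_of_hasCompactSupport isTestFunction_bump.2

/-- The mass of the bump lost in a centred ball under translation. -/
def massDefect (r : ℝ) (z : 𝔼) : ℝ :=
  (∫ x in Metric.ball (0 : 𝔼) r, bump x) - ∫ x in Metric.ball (0 : 𝔼) r, bump (x + z)

/-- Ball and bump are both even, so the translates by `z` and by `-z` have equal mass in the ball.
-/
theorem setIntegral_secondDiff_bump (r : ℝ) (z : 𝔼) :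
    ∫ x in Metric.ball 0 r, secondDiff bump x z = 2 * massDefect r z := by
  have h1 : Integrable fun x : 𝔼 => bump (x + z) := integrable_bump.comp_add_right z
  have h2 : Integrable fun x : 𝔼 => bump (x - z) := integrable_bump.comp_sub_right z
  have h3 : ∫ x in Metric.ball 0 r, bump (x - z) = ∫ x in Metric.ball 0 r, bump (x + z) := by
    rw [← integral_indicator Metric.isOpen_ball.measurableSet,
      ← integral_indicator Metric.isOpen_ball.measurableSet, ← integral_neg_eq_self]
    congr 1; ext x
    by_cases hx : ‖x‖ < r
    · simp only [Set.indicator, mem_ball_zero_iff, norm_neg, hx, if_true]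
      rw [← bump_neg]; congr 1; abel
    · simp [Set.indicator, hx]
  have h4 : Integrable fun x : 𝔼 => 2 * bump x := integrable_bump.const_mul 2
  have h5 : Integrable fun x : 𝔼 => 2 * bump x - bump (x + z) := h4.sub h1
  simp only [secondDiff]
  rw [integral_sub h5.integrableOn h2.integrableOn, integral_sub h4.integrableOn h1.integrableOn,
    integral_const_mul, h3, massDefect]
  ring

theorem massDefect_le (r : ℝ) (z : 𝔼) : massDefect r z ≤ ∫ x : 𝔼, bump x := by
  have h1 : ∫ x in Metric.ball (0 : 𝔼) r, bump x ≤ ∫ x : 𝔼, bump x :=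
    setIntegral_le_integral integrable_bump (.of_forall bump_nonneg)
  have h2 : 0 ≤ ∫ x in Metric.ball (0 : 𝔼) r, bump (x + z) :=
    integral_nonneg fun x => bump_nonneg _
  rw [massDefect]; linarith

theorem massDefect_eq_zero {r : ℝ} {z : 𝔼} (h : ‖z‖ + 1 ≤ r) : massDefect r z = 0 := by
  rw [massDefect, sub_eq_zero, setIntegral_eq_integral_of_forall_compl_eq_zero,
    setIntegral_eq_integral_of_forall_compl_eq_zero, integral_add_right_eq_self]
  · intro x hx
    rw [mem_ball_zero_iff, not_lt] at hx
    refine bump_eq_zero ?_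
    have := norm_sub_norm_le x (-z)
    rw [norm_neg, sub_neg_eq_add] at this
    linarith
  · intro x hx
    rw [mem_ball_zero_iff, not_lt] at hx
    exact bump_eq_zero (by linarith [norm_nonneg z])

theorem massDefect_pos {r : ℝ} (hr : 0 < r) {z : 𝔼} (h : r + 1 ≤ ‖z‖) :
    0 < massDefect r z := by
  have h1 : ∫ x in Metric.ball (0 : 𝔼) r, bump (x + z) = 0 := by
    refine setIntegral_eq_zero_of_forall_eq_zero fun x hx => bump_eq_zero ?_
    rw [mem_ball_zero_iff] at hx
    have := norm_sub_norm_le z (-x)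
    rw [norm_neg, sub_neg_eq_add, add_comm] at this
    linarith
  rw [massDefect, h1, sub_zero,
    setIntegral_pos_iff_support_of_nonneg_ae (.of_forall bump_nonneg) integrable_bump.integrableOn]
  refine lt_of_lt_of_le (Metric.measure_ball_pos volume (0 : 𝔼) (lt_min hr one_pos))
    (measure_mono fun x hx => ?_)
  rw [mem_ball_zero_iff, lt_min_iff] at hx
  exact ⟨(bump_pos hx.2).ne', mem_ball_zero_iff.2 hx.1⟩

/-- Among all translates, the centred bump has the largest mass in a centred ball. -/
theorem massDefect_nonneg {r : ℝ} (hr : 0 ≤ r) (z : 𝔼) : 0 ≤ massDefect r z := by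
  -- `c` is the value of the bump on the sphere of radius `r`. The centred ball is then where `bump
  -- - c` equals its positive part `p`, and `p` vanishes outside it. Hence the centred integral of
  -- `bump - c` is the whole of `∫ p`, which no translate can exceed.
  set c := expNegInvGlue (1 - r ^ 2) with hc
  have hc0 : 0 ≤ c := expNegInvGlue.nonneg _
  set p : 𝔼 → ℝ := fun x => max (bump x - c) 0 with hp
  have hpc : Continuous p := (continuous_bump.sub continuous_const).max continuous_const
  have hps : HasCompactSupport p := by
    refine isTestFunction_bump.2.mono fun x hx => ?_
    contrapose! hx
    simp only [Function.mem_support, not_not] at hx ⊢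
    simp [hp, hx, hc0]
  have hpi : Integrable p := hpc.integrable_of_hasCompactSupport hps
  have hfin : volume (Metric.ball (0 : 𝔼) r) ≠ ⊤ := measure_ball_lt_top.ne
  have hci : IntegrableOn (fun _ => c) (Metric.ball (0 : 𝔼) r) := integrableOn_const hfin
  have hb : IntegrableOn (bump : 𝔼 → ℝ) (Metric.ball 0 r) := integrable_bump.integrableOn
  have hbz : IntegrableOn (fun x : 𝔼 => bump (x + z)) (Metric.ball 0 r) :=
    (integrable_bump.comp_add_right z).integrableOn
  have h1 : ∫ x in Metric.ball (0 : 𝔼) r, (bump x - c) = ∫ x, p x := by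
    rw [← setIntegral_eq_integral_of_forall_compl_eq_zero (s := Metric.ball (0 : 𝔼) r) (f := p)]
    · refine setIntegral_congr_fun Metric.isOpen_ball.measurableSet fun x hx => ?_
      rw [mem_ball_zero_iff] at hx
      refine (max_eq_left (sub_nonneg.2 ?_)).symm
      exact expNegInvGlue.monotone (by gcongr)
    · intro x hx
      rw [mem_ball_zero_iff, not_lt] at hx
      refine max_eq_right (sub_nonpos.2 ?_)
      exact expNegInvGlue.monotone (by gcongr)
  have h2 : ∫ x in Metric.ball (0 : 𝔼) r, (bump (x + z) - c) ≤ ∫ x, p x := by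
    calc ∫ x in Metric.ball (0 : 𝔼) r, (bump (x + z) - c)
        ≤ ∫ x in Metric.ball (0 : 𝔼) r, p (x + z) :=
          integral_mono (hbz.sub hci) (hpi.comp_add_right z).integrableOn
            fun x => le_max_left _ _
      _ ≤ ∫ x, p (x + z) := setIntegral_le_integral (hpi.comp_add_right z)
          (.of_forall fun x => le_max_right _ _)
      _ = ∫ x, p x := integral_add_right_eq_self _ _
  rw [integral_sub hb hci] at h1
  rw [integral_sub hbz hci] at h2
  rw [massDefect]; linarith

theorem normConst_pos {s : ℝ} (hs₀ : 0 < s) (hs₁ : s < 1) : 0 < normConst n s := by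
  have h1 : 0 < Real.Gamma ((n : ℝ) / 2 + s) := Real.Gamma_pos_of_pos (by positivity)
  have h2 : 0 < Real.Gamma (1 - s) := Real.Gamma_pos_of_pos (by linarith)
  unfold normConst
  positivity

/-! ### The mean value kernel for `0 < s < 1` -/

section Fractional

variable {s : ℝ}

theorem integrable_secondDiff_bump_div (hn : n ≠ 0) (hs₀ : 0 < s) (hs₁ : s < 1) (r : ℝ) :
    Integrable (fun p : 𝔼 × 𝔼 => secondDiff bump p.1 p.2 / ‖p.2‖ ^ ((n : ℝ) + 2 * s))
      ((volume.restrict (Metric.ball 0 r)).prod volume) := by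
  have hκ := integrable_singularWeight (n := n) (a := (n : ℝ) + 2 * s) hn (by linarith)
    (by linarith)
  obtain ⟨C, hC0, hC⟩ := (isTestFunction_bump (n := n)).exists_abs_secondDiff_le
  have : IsFiniteMeasure ((volume : Measure 𝔼).restrict (Metric.ball 0 r)) :=
    ⟨by rw [Measure.restrict_apply_univ]; exact measure_ball_lt_top⟩
  refine ((hκ.comp_snd _).const_mul C).mono'
    (measurable_secondDiff_div continuous_bump).aestronglyMeasurable (.of_forall fun p => ?_)
  exact IsTestFunction.abs_secondDiff_div_le (hC _ _)

/-- The integral of the fractional Laplacian of the bump over a centred ball. -/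
theorem setIntegral_fracLaplacian_bump (hn : n ≠ 0) (hs₀ : 0 < s) (hs₁ : s < 1) (r : ℝ) :
    ∫ x in Metric.ball (0 : 𝔼) r, fracLaplacian s bump x =
      normConst n s * ∫ z : 𝔼, massDefect r z / ‖z‖ ^ ((n : ℝ) + 2 * s) := by
  have h := integrable_secondDiff_bump_div (n := n) hn hs₀ hs₁ r
  simp only [(isTestFunction_bump (n := n)).fracLaplacian_eq hn hs₀ hs₁]
  rw [integral_const_mul, integral_const_mul, integral_integral_swap h]
  congr 1
  rw [← integral_const_mul]
  congr 1; ext z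
  rw [integral_div, setIntegral_secondDiff_bump]
  ring

theorem integrable_massDefect (hn : n ≠ 0) (hs₀ : 0 < s) (hs₁ : s < 1) (r : ℝ) :
    Integrable fun z : 𝔼 => massDefect r z / ‖z‖ ^ ((n : ℝ) + 2 * s) := by
  have h := (integrable_secondDiff_bump_div (n := n) hn hs₀ hs₁ r).integral_prod_right
  refine (h.const_mul (1 / 2)).congr (.of_forall fun z => ?_)
  simp only
  rw [integral_div, setIntegral_secondDiff_bump]
  ring

/-- Strictness comes from translations with `|z| ≥ r + 1`, which empty the ball of mass. -/
theorem setIntegral_fracLaplacian_bump_pos (hn : n ≠ 0) (hs₀ : 0 < s) (hs₁ : s < 1) {r : ℝ}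
    (hr : 0 < r) : 0 < ∫ x in Metric.ball (0 : 𝔼) r, fracLaplacian s bump x := by
  have : NeZero n := ⟨hn⟩
  rw [setIntegral_fracLaplacian_bump hn hs₀ hs₁]
  refine mul_pos (normConst_pos hs₀ hs₁) ?_
  rw [integral_pos_iff_support_of_nonneg
    (fun z => div_nonneg (massDefect_nonneg hr.le z) (by positivity))
    (integrable_massDefect hn hs₀ hs₁ r)]
  obtain ⟨v, hv⟩ := exists_norm_eq 𝔼 (c := r + 3) (by linarith)
  refine lt_of_lt_of_le (Metric.measure_ball_pos volume v one_pos) (measure_mono fun x hx => ?_)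
  rw [mem_ball_iff_norm'] at hx
  have hx1 : r + 1 ≤ ‖x‖ := by
    have := norm_sub_norm_le v x
    linarith
  have hx0 : 0 < ‖x‖ := by linarith
  exact (div_pos (massDefect_pos hr hx1) (by positivity)).ne'

theorem integral_indicator_rpow_norm (a : ℝ) {ρ : ℝ} (hρ : 0 < ρ) :
    ∫ z : 𝔼, {z : 𝔼 | ρ ≤ ‖z‖}.indicator (fun z => (‖z‖ ^ a)⁻¹) z =
      (ρ ^ n * (ρ ^ a)⁻¹) * ∫ z : 𝔼, {z : 𝔼 | 1 ≤ ‖z‖}.indicator (fun z => (‖z‖ ^ a)⁻¹) z := by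
  have h1 := Measure.integral_comp_smul (volume : Measure 𝔼)
    ({z : 𝔼 | 1 ≤ ‖z‖}.indicator (fun z => (‖z‖ ^ a)⁻¹)) ρ⁻¹
  simp only [finrank_euclideanSpace, Fintype.card_fin, inv_pow, inv_inv,
    abs_of_pos (pow_pos hρ n), smul_eq_mul] at h1
  rw [mul_comm (ρ ^ n), mul_assoc, ← h1, ← integral_const_mul]
  congr 1; ext z
  have h2 : ‖ρ⁻¹ • z‖ = ρ⁻¹ * ‖z‖ := by
    rw [norm_smul, Real.norm_of_nonneg (inv_pos.2 hρ).le]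
  have h3 : 1 ≤ ρ⁻¹ * ‖z‖ ↔ ρ ≤ ‖z‖ := by
    rw [inv_mul_eq_div, one_le_div hρ]
  have h4 : 0 < ρ ^ a := by positivity
  by_cases hz : ρ ≤ ‖z‖
  · simp only [Set.indicator, Set.mem_ofPred_eq, h2, h3, hz, if_true,
      Real.mul_rpow (inv_pos.2 hρ).le (norm_nonneg z), Real.inv_rpow hρ.le]
    rw [mul_inv, inv_inv, ← mul_assoc, inv_mul_cancel₀ h4.ne', one_mul]
  · simp [Set.indicator, h2, h3, hz]

theorem integrable_indicator_rpow_norm (hn : n ≠ 0) (hs₀ : 0 < s) (hs₁ : s < 1) {ρ : ℝ}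
    (hρ : 0 < ρ) : Integrable
      ({z : 𝔼 | ρ ≤ ‖z‖}.indicator (fun z => (‖z‖ ^ ((n : ℝ) + 2 * s))⁻¹)) := by
  have hκ := integrable_singularWeight (n := n) (a := (n : ℝ) + 2 * s) hn (by linarith)
    (by linarith)
  have hm : 0 < min (ρ ^ 2) 1 := by positivity
  refine (hκ.const_mul (min (ρ ^ 2) 1)⁻¹).mono' ?_ (.of_forall fun z => ?_)
  · exact (Measurable.indicator (by fun_prop)
      (measurableSet_le measurable_const measurable_norm)).aestronglyMeasurable
  · by_cases hz : ρ ≤ ‖z‖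
    · rw [Set.indicator_of_mem (by exact hz), norm_inv, Real.norm_of_nonneg (by positivity),
        singularWeight, ← mul_div_assoc, ← one_div]
      refine div_le_div_of_nonneg_right ?_ (by positivity)
      rw [inv_mul_eq_div, one_le_div hm]
      exact min_le_min_right _ (by gcongr)
    · rw [Set.indicator_of_notMem (by exact hz), norm_zero]
      exact mul_nonneg (by positivity) (singularWeight_nonneg z)

/-- The mass defect vanishes for `|z| ≤ r - 1`, hence for `|z| < r / 2` since `r ≥ 2`, and is
otherwise at most the total mass. What remains is the tail of `|z| ^ (-n - 2 * s)` beyond `r / 2`,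
of order `r ^ (-2 * s)`. -/
theorem exists_setIntegral_fracLaplacian_bump_le (hn : n ≠ 0) (hs₀ : 0 < s) (hs₁ : s < 1) :
    ∃ K, 0 ≤ K ∧ ∀ r, 2 ≤ r → ∫ x in Metric.ball (0 : 𝔼) r, fracLaplacian s bump x ≤
      K * (r ^ n * (r ^ ((n : ℝ) + 2 * s))⁻¹) := by
  have hc := normConst_pos (n := n) hs₀ hs₁
  set a := (n : ℝ) + 2 * s with ha
  set T := ∫ z : 𝔼, {z : 𝔼 | 1 ≤ ‖z‖}.indicator (fun z => (‖z‖ ^ a)⁻¹) z with hT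
  have hT0 : 0 ≤ T := integral_nonneg fun z =>
    Set.indicator_nonneg (fun z _ => by positivity) z
  set m := ∫ x : 𝔼, bump x with hm
  have hm0 : 0 ≤ m := integral_nonneg bump_nonneg
  refine ⟨normConst n s * (m * (2 ^ a * T)), by positivity, fun r hr => ?_⟩
  have hr0 : 0 < r := by linarith
  have hρ : 0 < r / 2 := by linarith
  have hi := integrable_indicator_rpow_norm (n := n) hn hs₀ hs₁ hρ
  rw [← ha] at hi
  rw [setIntegral_fracLaplacian_bump hn hs₀ hs₁, mul_assoc]
  refine mul_le_mul_of_nonneg_left ?_ hc.le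
  calc ∫ z : 𝔼, massDefect r z / ‖z‖ ^ a
      ≤ ∫ z : 𝔼, m * {z : 𝔼 | r / 2 ≤ ‖z‖}.indicator (fun z => (‖z‖ ^ a)⁻¹) z := by
        refine integral_mono_of_nonneg
          (.of_forall fun z => div_nonneg (massDefect_nonneg hr0.le z) (by positivity))
          (hi.const_mul m) (.of_forall fun z => ?_)
        simp only
        by_cases hz : r / 2 ≤ ‖z‖
        · rw [Set.indicator_of_mem (by exact hz), div_eq_mul_inv]
          exact mul_le_mul_of_nonneg_right (massDefect_le r z) (by positivity)
        · rw [Set.indicator_of_notMem (by exact hz), massDefect_eq_zero (by linarith)]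
          simp
    _ = m * ((r / 2) ^ n * ((r / 2) ^ a)⁻¹ * T) := by
        rw [integral_const_mul, integral_indicator_rpow_norm a hρ]
    _ ≤ m * (r ^ n * (2 ^ a * (r ^ a)⁻¹) * T) := by
        have h1 : ((r / 2) ^ a)⁻¹ = 2 ^ a * (r ^ a)⁻¹ := by
          rw [Real.div_rpow hr0.le (by norm_num), inv_div, div_eq_mul_inv]
        rw [h1]
        gcongr
        linarith
    _ = _ := by ring

/-- The segment mean of a radial function through its integral over a ball. -/
theorem setIntegral_ball_eq_segmentMean (hn : n ≠ 0) {g : 𝔼 → ℝ} (hg : IsRadial g) (y : 𝔼) :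
    ∫ x in Metric.ball (0 : 𝔼) ‖y‖, g x =
      n * volume.real (Metric.ball (0 : 𝔼) 1) * (‖y‖ ^ n * segmentMean g y) := by
  have : NeZero n := ⟨hn⟩
  obtain ⟨e, he⟩ := exists_norm_eq 𝔼 zero_le_one
  set r := ‖y‖ with hr
  have hr0 : 0 ≤ r := norm_nonneg y
  have h1 : ∫ x in Metric.ball (0 : 𝔼) r, g x =
      ∫ x : 𝔼, (Set.Iio r).indicator (fun t => g (t • e)) ‖x‖ := by
    rw [← integral_indicator Metric.isOpen_ball.measurableSet]
    congr 1; ext x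
    by_cases hx : ‖x‖ < r
    · simp only [Set.indicator, mem_ball_zero_iff, Set.mem_Iio, hx, if_true]
      exact hg _ _ (by rw [norm_smul, he, norm_norm, mul_one])
    · simp [Set.indicator, hx]
  have h2 : segmentMean g y = segmentMean g (r • e) := by
    unfold segmentMean
    congr 1; ext σ; congr 1
    exact hg _ _ (by rw [norm_smul, norm_smul, norm_smul, he, norm_norm, mul_one])
  rw [h1, integral_fun_norm_addHaar volume, h2, pow_mul_segmentMean_smul hn]
  simp only [finrank_euclideanSpace, Fintype.card_fin, nsmul_eq_mul, smul_eq_mul]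
  rw [mul_assoc]
  congr 2
  rw [intervalIntegral.integral_of_le hr0, integral_Ioc_eq_integral_Ioo,
    ← integral_indicator measurableSet_Ioi, ← integral_indicator measurableSet_Ioo]
  congr 1; ext t
  by_cases h0 : 0 < t <;> by_cases h3 : t < r <;> simp [Set.indicator, h0, h3]

/-- A continuous function that decays like `|x|^{-a}` is dominated by the weight. -/
theorem exists_le_weight_of_decay {a : ℝ} (ha : 0 ≤ a) {k : 𝔼 → ℝ} (hk : Continuous k) {K : ℝ}
    (hK0 : 0 ≤ K) (hK : ∀ x, 2 ≤ ‖x‖ → |k x| ≤ K * (‖x‖ ^ a)⁻¹) :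
    ∃ C, ∀ x, |k x| ≤ C * weight a x := by
  obtain ⟨B, hB⟩ := (isCompact_closedBall (0 : 𝔼) 2).exists_bound_of_continuousOn hk.continuousOn
  refine ⟨|B| * 5 ^ (a / 2) + K * 2 ^ (a / 2), fun x => ?_⟩
  have hw := weight_pos (a := a) x
  by_cases hx : ‖x‖ ≤ 2
  · have h1 : 1 ≤ 5 ^ (a / 2) * weight a x := by
      have h3 := weight_le_of_le (n := n) ha (c := 5) (by norm_num)
        (x := x) (y := 0) (by simp only [norm_zero]; nlinarith [norm_nonneg x])
      simpa [weight] using h3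
    calc |k x| ≤ |B| := (hB x (mem_closedBall_zero_iff.2 hx)).trans (le_abs_self B)
      _ ≤ |B| * (5 ^ (a / 2) * weight a x) := le_mul_of_one_le_right (abs_nonneg B) h1
      _ ≤ _ := by rw [add_mul, mul_assoc]; exact le_add_of_nonneg_right (by positivity)
  · push Not at hx
    have hx0 : 0 < ‖x‖ := by linarith
    have h1 : (‖x‖ ^ a)⁻¹ ≤ 2 ^ (a / 2) * weight a x := by
      have h2 : ‖x‖ ^ a = (‖x‖ ^ 2) ^ (a / 2) := by
        rw [← Real.rpow_natCast, ← Real.rpow_mul hx0.le]; congr 1; push_cast; ring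
      rw [weight, neg_div, Real.rpow_neg (by positivity), h2, ← div_eq_mul_inv,
        ← Real.div_rpow (by norm_num) (by positivity), ← Real.inv_rpow (by positivity)]
      refine Real.rpow_le_rpow (by positivity) ?_ (by positivity)
      rw [inv_eq_one_div, div_le_div_iff₀ (by positivity) (by positivity)]
      nlinarith
    calc |k x| ≤ K * (‖x‖ ^ a)⁻¹ := hK x hx.le
      _ ≤ K * (2 ^ (a / 2) * weight a x) := by gcongr
      _ ≤ _ := by rw [add_mul, ← mul_assoc]; exact le_add_of_nonneg_left (by positivity)

/-- For `|x| ≥ 2` the bump vanishes at `x`, and only `z` with `|x + z| < 1` or `|x - z| < 1`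
contribute; there `|z| ≥ |x| - 1 ≥ |x| / 2`. -/
theorem exists_abs_fracLaplacian_bump_le (hn : n ≠ 0) (hs₀ : 0 < s) (hs₁ : s < 1) :
    ∃ K, 0 ≤ K ∧ ∀ x : 𝔼, 2 ≤ ‖x‖ →
      |fracLaplacian s bump x| ≤ K * (‖x‖ ^ ((n : ℝ) + 2 * s))⁻¹ := by
  have hc := normConst_pos (n := n) hs₀ hs₁
  have hm0 : 0 ≤ ∫ x : 𝔼, bump x := integral_nonneg bump_nonneg
  set a := (n : ℝ) + 2 * s with ha
  have ha0 : 0 < a := by positivity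
  refine ⟨normConst n s * (2 ^ a * ∫ x : 𝔼, bump x), by positivity, fun x hx => ?_⟩
  have hx0 : 0 < ‖x‖ := by linarith
  rw [(isTestFunction_bump (n := n)).fracLaplacian_eq hn hs₀ hs₁, ← ha, abs_mul, abs_of_pos hc,
    mul_assoc]
  refine mul_le_mul_of_nonneg_left ?_ hc.le
  have i1 : Integrable fun z : 𝔼 => bump (x + z) := integrable_bump.comp_add_left x
  have i2 : Integrable fun z : 𝔼 => bump (x - z) := integrable_bump.comp_sub_left x
  have hpt : ∀ w z : 𝔼, ‖x‖ - 1 ≤ ‖z‖ ∨ bump w = 0 → bump w / ‖z‖ ^ a ≤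
      bump w * (2 ^ a * (‖x‖ ^ a)⁻¹) := by
    rintro w z (hz | hw)
    · rw [div_eq_mul_inv]
      refine mul_le_mul_of_nonneg_left ?_ (bump_nonneg w)
      have h1 : 2 ^ a * (‖x‖ ^ a)⁻¹ = ((‖x‖ / 2) ^ a)⁻¹ := by
        rw [Real.div_rpow hx0.le (by norm_num), inv_div, div_eq_mul_inv]
      rw [h1]
      exact inv_anti₀ (by positivity) (Real.rpow_le_rpow (by positivity) (by linarith) ha0.le)
    · simp [hw]
  have hbd : |∫ z : 𝔼, secondDiff bump x z / ‖z‖ ^ a| ≤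
      ∫ z : 𝔼, (bump (x + z) + bump (x - z)) * (2 ^ a * (‖x‖ ^ a)⁻¹) := by
    rw [← Real.norm_eq_abs]
    refine norm_integral_le_of_norm_le ((i1.add i2).mul_const _) (.of_forall fun z => ?_)
    have h1 : secondDiff bump x z / ‖z‖ ^ a =
        -(bump (x + z) / ‖z‖ ^ a + bump (x - z) / ‖z‖ ^ a) := by
      rw [secondDiff, bump_eq_zero (by linarith : 1 ≤ ‖x‖)]; ring
    have h2 : 0 ≤ bump (x + z) / ‖z‖ ^ a := div_nonneg (bump_nonneg _) (by positivity)
    have h3 : 0 ≤ bump (x - z) / ‖z‖ ^ a := div_nonneg (bump_nonneg _) (by positivity)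
    rw [h1, norm_neg, Real.norm_of_nonneg (by positivity), add_mul]
    refine add_le_add (hpt _ _ ?_) (hpt _ _ ?_)
    · by_cases h : 1 ≤ ‖x + z‖
      · exact .inr (bump_eq_zero h)
      · left
        have := norm_sub_norm_le x (-z)
        rw [norm_neg, sub_neg_eq_add] at this
        linarith
    · by_cases h : 1 ≤ ‖x - z‖
      · exact .inr (bump_eq_zero h)
      · left
        have := norm_sub_norm_le x z
        linarith
  rw [integral_mul_const, integral_add i1 i2, integral_add_left_eq_self,
    integral_sub_left_eq_self] at hbd
  rw [abs_mul, abs_of_pos (by norm_num : (0 : ℝ) < 1 / 2)]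
  linarith

/-- For `0 < s < 1`, the fractional Laplacian of the bump generates mean value kernels. -/
theorem isMeanGenerator_fracLaplacian_bump_of_lt (hn : n ≠ 0) (hs₀ : 0 < s) (hs₁ : s < 1) :
    IsMeanGenerator ((n : ℝ) + 2 * s) (fracLaplacian s (bump : 𝔼 → ℝ)) := by
  have : NeZero n := ⟨hn⟩
  have hb := isTestFunction_bump (n := n)
  have hcont := hb.continuous_fracLaplacian hn hs₀ hs₁
  have hrad := hb.isRadial_fracLaplacian hn hs₀ hs₁ isRadial_bump
  have ha0 : 0 ≤ (n : ℝ) + 2 * s := by positivity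
  have hω : 0 < (n : ℝ) * volume.real (Metric.ball (0 : 𝔼) 1) := by
    refine mul_pos (Nat.cast_pos.2 (Nat.pos_of_ne_zero hn)) ?_
    exact ENNReal.toReal_pos (Metric.measure_ball_pos volume _ one_pos).ne'
      measure_ball_lt_top.ne
  have hpos : ∀ x : 𝔼, x ≠ 0 → 0 < segmentMean (fracLaplacian s bump) x := by
    intro x hx
    have hx0 : 0 < ‖x‖ := norm_pos_iff.2 hx
    have h1 := setIntegral_fracLaplacian_bump_pos (n := n) hn hs₀ hs₁ hx0
    rw [setIntegral_ball_eq_segmentMean hn hrad] at h1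
    have h2 := pos_of_mul_pos_right h1 hω.le
    exact pos_of_mul_pos_right h2 (pow_pos hx0 n).le
  have hcm := continuous_segmentMean hcont
  have hnonneg : ∀ x : 𝔼, 0 ≤ segmentMean (fracLaplacian s bump) x := by
    -- At the origin the ball degenerates and the mass formula says nothing; continuity supplies the
    -- sign.
    have hd : Dense ({0}ᶜ : Set 𝔼) := dense_compl_singleton 0
    have hcl : IsClosed {x : 𝔼 | 0 ≤ segmentMean (fracLaplacian s bump) x} :=
      isClosed_le continuous_const hcm
    intro x
    exact hcl.closure_subset_iff.2 (fun y hy => (hpos y hy).le) (hd x)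
  refine ⟨hcont, ?_, hnonneg, ?_, fun x hx _ => hpos x hx⟩
  · obtain ⟨K, hK0, hK⟩ := exists_abs_fracLaplacian_bump_le (n := n) hn hs₀ hs₁
    exact exists_le_weight_of_decay ha0 hcont hK0 hK
  · obtain ⟨K, hK0, hK⟩ := exists_setIntegral_fracLaplacian_bump_le (n := n) hn hs₀ hs₁
    obtain ⟨C, hC⟩ := exists_le_weight_of_decay ha0 hcm
      (K := K / (n * volume.real (Metric.ball (0 : 𝔼) 1))) (div_nonneg hK0 hω.le) fun x hx => by
        have hx0 : 0 < ‖x‖ := by linarith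
        rw [abs_of_nonneg (hnonneg x), div_mul_eq_mul_div, le_div_iff₀ hω]
        have h1 := hK ‖x‖ hx
        rw [setIntegral_ball_eq_segmentMean hn hrad] at h1
        have h2 : 0 < ‖x‖ ^ n := pow_pos hx0 n
        refine le_of_mul_le_mul_left ?_ h2
        calc _ = _ := by ring
          _ ≤ _ := h1
          _ = _ := by ring
    exact ⟨C, fun x => (le_abs_self _).trans (hC x)⟩

end Fractional

/-! ### The mean value kernel for `s = 1` -/

section Classical

theorem laplacian_eq_sum_fderiv {h : 𝔼 → ℝ} (hh : ContDiff ℝ 2 h) (x : 𝔼) :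
    Laplacian.laplacian h x = ∑ i, fderiv ℝ
      (fun y => fderiv ℝ h y (EuclideanSpace.basisFun (Fin n) ℝ i)) x
      (EuclideanSpace.basisFun (Fin n) ℝ i) := by
  rw [InnerProductSpace.laplacian_eq_iteratedFDeriv_orthonormalBasis h
    (EuclideanSpace.basisFun (Fin n) ℝ)]
  refine Finset.sum_congr rfl fun i _ => ?_
  rw [iteratedFDeriv_two_apply]
  have hd : DifferentiableAt ℝ (fderiv ℝ h) x :=
    ((hh.fderiv_right (m := 1) (by norm_num)).differentiable (by norm_num)).differentiableAt
  have h1 := (hd.hasFDerivAt.clm_apply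
    (hasFDerivAt_const (EuclideanSpace.basisFun (Fin n) ℝ i) x)).fderiv
  rw [h1]
  simp

theorem laplacian_comp_smul_sub {h : 𝔼 → ℝ} (hh : ContDiff ℝ 2 h) (σ : ℝ) (x y : 𝔼) :
    Laplacian.laplacian (fun y => h (σ • (x - y))) y =
      σ ^ 2 * Laplacian.laplacian h (σ • (x - y)) := by
  have hc : ContDiff ℝ 2 fun y : 𝔼 => h (σ • (x - y)) := hh.comp (by fun_prop)
  have hA : ∀ y : 𝔼, HasFDerivAt (fun y : 𝔼 => σ • (x - y))
      (σ • -ContinuousLinearMap.id ℝ 𝔼) y := fun y =>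
    ((hasFDerivAt_id y).const_sub x).const_smul σ
  have hd : Differentiable ℝ h := hh.differentiable (by norm_num)
  have hd2 : Differentiable ℝ (fderiv ℝ h) :=
    (hh.fderiv_right (m := 1) (by norm_num)).differentiable (by norm_num)
  rw [laplacian_eq_sum_fderiv hc, laplacian_eq_sum_fderiv hh, Finset.mul_sum]
  refine Finset.sum_congr rfl fun i _ => ?_
  set v := EuclideanSpace.basisFun (Fin n) ℝ i
  have h1 : ∀ y : 𝔼, fderiv ℝ (fun y => h (σ • (x - y))) y v =
      -σ * fderiv ℝ h (σ • (x - y)) v := fun y => by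
    have := ((hd _).hasFDerivAt.comp y (hA y)).fderiv
    rw [show (fun y => h (σ • (x - y))) = h ∘ fun y => σ • (x - y) from rfl, this]
    simp
  have hk : DifferentiableAt ℝ (fun y => fderiv ℝ h y v) (σ • (x - y)) :=
    (hd2 _).clm_apply (differentiableAt_const _)
  have h2 := ((hk.hasFDerivAt.comp y (hA y)).const_mul (-σ)).fderiv
  simp only [h1]
  rw [show (fun y => -σ * fderiv ℝ h (σ • (x - y)) v) =
    fun z => -σ * ((fun y => fderiv ℝ h y v) ∘ fun y => σ • (x - y)) z from rfl, h2]
  simp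
  ring

theorem contDiff_expNegInvGlue : ContDiff ℝ ∞ expNegInvGlue := expNegInvGlue.contDiff

theorem contDiff_deriv_expNegInvGlue : ContDiff ℝ ∞ (deriv expNegInvGlue) :=
  (contDiff_infty_iff_deriv.1 contDiff_expNegInvGlue).2

theorem hasDerivAt_expNegInvGlue (t : ℝ) :
    HasDerivAt expNegInvGlue (deriv expNegInvGlue t) t :=
  (contDiff_expNegInvGlue.differentiable (by simp) t).hasDerivAt

theorem hasDerivAt_deriv_expNegInvGlue (t : ℝ) :
    HasDerivAt (deriv expNegInvGlue) (deriv (deriv expNegInvGlue) t) t :=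
  (contDiff_deriv_expNegInvGlue.differentiable (by simp) t).hasDerivAt

theorem deriv_expNegInvGlue_of_neg {t : ℝ} (ht : t < 0) : deriv expNegInvGlue t = 0 := by
  have h : expNegInvGlue =ᶠ[𝓝 t] fun _ => 0 := by
    filter_upwards [Iio_mem_nhds ht] with x hx
    exact expNegInvGlue.zero_of_nonpos (le_of_lt hx)
  rw [h.deriv_eq, deriv_const]

theorem deriv_deriv_expNegInvGlue_of_neg {t : ℝ} (ht : t < 0) :
    deriv (deriv expNegInvGlue) t = 0 := by
  have h : deriv expNegInvGlue =ᶠ[𝓝 t] fun _ => 0 := by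
    filter_upwards [Iio_mem_nhds ht] with x hx
    exact deriv_expNegInvGlue_of_neg hx
  rw [h.deriv_eq, deriv_const]

theorem deriv_expNegInvGlue_pos {t : ℝ} (ht : 0 < t) : 0 < deriv expNegInvGlue t := by
  have h : expNegInvGlue =ᶠ[𝓝 t] fun x => Real.exp (-x⁻¹) := by
    filter_upwards [Ioi_mem_nhds ht] with x hx
    rw [expNegInvGlue, if_neg (not_le.2 hx)]
  have h1 := ((hasDerivAt_inv ht.ne').neg.exp)
  rw [h.deriv_eq]
  have h2 : deriv (fun x : ℝ => Real.exp (-x⁻¹)) t = Real.exp (-t⁻¹) * - -(t ^ 2)⁻¹ := h1.deriv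
  rw [h2, neg_neg]
  positivity

theorem fderiv_bump_apply (x v : 𝔼) :
    fderiv ℝ bump x v = -2 * deriv expNegInvGlue (1 - ‖x‖ ^ 2) * inner ℝ x v := by
  have h1 : HasFDerivAt (fun x : 𝔼 => 1 - ‖x‖ ^ 2) (-(2 • innerSL ℝ x)) x :=
    (hasStrictFDerivAt_norm_sq x).hasFDerivAt.const_sub 1
  have h2 := ((hasDerivAt_expNegInvGlue (1 - ‖x‖ ^ 2)).comp_hasFDerivAt x h1).fderiv
  rw [show (bump : 𝔼 → ℝ) = expNegInvGlue ∘ fun x => 1 - ‖x‖ ^ 2 from rfl, h2]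
  simp
  ring

theorem laplacian_bump (x : 𝔼) : Laplacian.laplacian bump x =
    4 * ‖x‖ ^ 2 * deriv (deriv expNegInvGlue) (1 - ‖x‖ ^ 2) -
      2 * n * deriv expNegInvGlue (1 - ‖x‖ ^ 2) := by
  rw [laplacian_eq_sum_fderiv (isTestFunction_bump.1.of_le (WithTop.coe_le_coe.2 le_top))]
  simp only [fderiv_bump_apply]
  have h1 : HasFDerivAt (fun x : 𝔼 => 1 - ‖x‖ ^ 2) (-(2 • innerSL ℝ x)) x :=
    (hasStrictFDerivAt_norm_sq x).hasFDerivAt.const_sub 1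
  have h2 := ((hasDerivAt_deriv_expNegInvGlue (1 - ‖x‖ ^ 2)).comp_hasFDerivAt x h1).const_mul (-2)
  have h3 : ∀ v : 𝔼, fderiv ℝ
      (fun y : 𝔼 => -2 * deriv expNegInvGlue (1 - ‖y‖ ^ 2) * inner ℝ y v) x v =
      4 * deriv (deriv expNegInvGlue) (1 - ‖x‖ ^ 2) * (inner ℝ x v) ^ 2 -
        2 * deriv expNegInvGlue (1 - ‖x‖ ^ 2) * ‖v‖ ^ 2 := fun v => by
    have h4 : HasFDerivAt (fun y : 𝔼 => inner ℝ y v) (innerSL ℝ v) x := by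
      have := (innerSL ℝ v).hasFDerivAt (x := x)
      refine this.congr_of_eventuallyEq (.of_forall fun y => ?_)
      simp [real_inner_comm]
    have h5 := (h2.mul h4).fderiv
    rw [show (fun y : 𝔼 => -2 * deriv expNegInvGlue (1 - ‖y‖ ^ 2) * inner ℝ y v) =
      (fun y => -2 * (deriv expNegInvGlue ∘ fun x => 1 - ‖x‖ ^ 2) y) * fun y => inner ℝ y v
      from rfl, h5]
    simp
    ring
  simp only [h3, Finset.sum_sub_distrib, ← Finset.mul_sum]
  have h6 : ∑ i, inner ℝ x (EuclideanSpace.basisFun (Fin n) ℝ i) ^ 2 = ‖x‖ ^ 2 := by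
    rw [EuclideanSpace.real_norm_sq_eq]
    refine Finset.sum_congr rfl fun i _ => ?_
    rw [real_inner_comm, EuclideanSpace.basisFun_inner]
  rw [h6]
  simp
  ring

/-- The divergence theorem in radial form: the integrand is the derivative of `2 σ ^ n φ'(1 - σ²
|y|²)` with `φ = expNegInvGlue`, and this primitive vanishes at `σ = 0` because `n ≠ 0`. -/
theorem segmentMean_neg_laplacian_bump (hn : n ≠ 0) (y : 𝔼) :
    segmentMean (fun x => -Laplacian.laplacian bump x) y =
      2 * deriv expNegInvGlue (1 - ‖y‖ ^ 2) := by
  obtain ⟨k, rfl⟩ := Nat.exists_eq_succ_of_ne_zero hn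
  have h1 : ∀ σ : ℝ, HasDerivAt (fun σ : ℝ => σ ^ (k + 1) *
      (2 * deriv expNegInvGlue (1 - σ ^ 2 * ‖y‖ ^ 2)))
      (σ ^ (k + 1 - 1) * -Laplacian.laplacian bump (σ • y)) σ := fun σ => by
    have h2 : HasDerivAt (fun σ : ℝ => 1 - σ ^ 2 * ‖y‖ ^ 2) (-(2 * σ * ‖y‖ ^ 2)) σ := by
      have := ((hasDerivAt_pow 2 σ).mul_const (‖y‖ ^ 2)).const_sub 1
      simpa using this
    have h3 := (hasDerivAt_pow (k + 1) σ).mul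
      (((hasDerivAt_deriv_expNegInvGlue _).comp σ h2).const_mul 2)
    refine h3.congr_deriv ?_
    rw [laplacian_bump, norm_smul, mul_pow, Real.norm_eq_abs, sq_abs]
    simp only [Function.comp_apply, Nat.add_sub_cancel]
    push_cast
    ring
  rw [segmentMean]
  have hc2 : Continuous (deriv (deriv expNegInvGlue)) :=
    (contDiff_infty_iff_deriv.1 contDiff_deriv_expNegInvGlue).2.continuous
  have hc1 : Continuous (deriv expNegInvGlue) := contDiff_deriv_expNegInvGlue.continuous
  rw [intervalIntegral.integral_eq_sub_of_hasDerivAt (fun σ _ => h1 σ)]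
  · simp
  · simp only [laplacian_bump]
    exact Continuous.intervalIntegrable (by fun_prop) _ _

/-- The Laplacian of the bump generates mean value kernels. -/
theorem isMeanGenerator_neg_laplacian_bump (hn : n ≠ 0) :
    IsMeanGenerator ((n : ℝ) + 2) (fun x : 𝔼 => -Laplacian.laplacian bump x) := by
  have hc2 : Continuous (deriv (deriv expNegInvGlue)) :=
    (contDiff_infty_iff_deriv.1 contDiff_deriv_expNegInvGlue).2.continuous
  have hc1 : Continuous (deriv expNegInvGlue) := contDiff_deriv_expNegInvGlue.continuous
  have hcont : Continuous fun x : 𝔼 => -Laplacian.laplacian bump x := by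
    simp only [laplacian_bump]; fun_prop
  have ha0 : 0 ≤ (n : ℝ) + 2 := by positivity
  refine ⟨hcont, ?_, fun x => ?_, ?_, fun x _ hx => ?_⟩
  -- The function vanishes for `|x| ≥ 2`, so the decay constant is `0`, fixed here by `le_rfl`.
  · refine exists_le_weight_of_decay ha0 hcont le_rfl fun x hx => ?_
    have : 1 - ‖x‖ ^ 2 < 0 := by nlinarith
    rw [laplacian_bump, deriv_expNegInvGlue_of_neg this, deriv_deriv_expNegInvGlue_of_neg this]
    simp
  · rw [segmentMean_neg_laplacian_bump hn]
    have := expNegInvGlue.monotone.deriv_nonneg (x := 1 - ‖x‖ ^ 2)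
    positivity
  · obtain ⟨C, hC⟩ := exists_le_weight_of_decay ha0 (continuous_segmentMean hcont) le_rfl
      fun x hx => by
        have : 1 - ‖x‖ ^ 2 < 0 := by nlinarith
        rw [segmentMean_neg_laplacian_bump hn, deriv_expNegInvGlue_of_neg this]
        simp
    exact ⟨C, fun x => (le_abs_self _).trans (hC x)⟩
  · rw [segmentMean_neg_laplacian_bump hn]
    have := deriv_expNegInvGlue_pos (t := 1 - ‖x‖ ^ 2) (by nlinarith [norm_nonneg x])
    positivity

theorem fracLaplacian_one (h : 𝔼 → ℝ) :
    fracLaplacian 1 h = fun x => -Laplacian.laplacian h x := by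
  ext x; simp [fracLaplacian]

end Classical

/-! ### Generator and scaling for all `0 < s ≤ 1` -/

section BothCases

variable {s : ℝ}

theorem isMeanGenerator_fracLaplacian_bump (hn : n ≠ 0) (hs₀ : 0 < s) (hs₁ : s ≤ 1) :
    IsMeanGenerator ((n : ℝ) + 2 * s) (fracLaplacian s (bump : 𝔼 → ℝ)) := by
  rcases hs₁.lt_or_eq with h | rfl
  · exact isMeanGenerator_fracLaplacian_bump_of_lt hn hs₀ h
  · rw [fracLaplacian_one, mul_one]
    exact isMeanGenerator_neg_laplacian_bump hn

theorem fracLaplacian_bump_comp_smul_sub (hn : n ≠ 0) (hs₀ : 0 < s) (hs₁ : s ≤ 1) {σ : ℝ}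
    (hσ : 0 < σ) (x y : 𝔼) : fracLaplacian s (fun y => bump (σ • (x - y))) y =
      σ ^ (2 * s) * fracLaplacian s bump (σ • (x - y)) := by
  rcases hs₁.lt_or_eq with h | rfl
  · exact isTestFunction_bump.fracLaplacian_comp_smul_sub_of_lt hn hs₀ h hσ x y
  · simp only [fracLaplacian_one]
    rw [laplacian_comp_smul_sub (isTestFunction_bump.1.of_le (WithTop.coe_le_coe.2 le_top)), mul_one,
      Real.rpow_two]
    ring

end BothCases

/-! ### Functions with the exact mean value property -/

section MeanValue

variable {a : ℝ} {g w : EuclideanSpace ℝ (Fin n) → ℝ}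

/-- Continuous functions with the mean value property for the kernels generated by `g`. -/
structure HasMeanValue (a : ℝ) (g w : 𝔼 → ℝ) : Prop where
  continuous : Continuous w
  integrable : Integrable fun x => w x * weight a x
  mean_eq : ∀ l : ℝ, 0 < l → ∀ x, kernelMean g w l x = (∫ z, segmentMean g z) * w x

theorem HasMeanValue.neg (hw : HasMeanValue a g w) : HasMeanValue a g fun x => -w x := by
  refine ⟨hw.continuous.neg, ?_, fun l hl x => ?_⟩
  · simpa only [neg_mul] using hw.integrable.fun_neg
  · have h := hw.mean_eq l hl x
    simp only [kernelMean, neg_mul, integral_neg] at h ⊢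
    rw [h]; ring

theorem HasMeanValue.sub (hg : IsMeanGenerator a g) (ha : (n : ℝ) < a) {v : 𝔼 → ℝ}
    (hv : HasMeanValue a g v) (hw : HasMeanValue a g w) :
    HasMeanValue a g fun x => v x - w x := by
  have ha0 : 0 ≤ a := (Nat.cast_nonneg n).trans ha.le
  refine ⟨hv.continuous.sub hw.continuous, ?_, fun l hl x => ?_⟩
  · simp only [sub_mul]
    exact Integrable.sub hv.integrable hw.integrable
  · have h1 := hv.mean_eq l hl x
    have h2 := hw.mean_eq l hl x
    rw [mul_sub, ← h1, ← h2, kernelMean, kernelMean, kernelMean,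
      ← integral_sub (hg.integrable_mul_kernel ha0 hv.integrable hl x)
        (hg.integrable_mul_kernel ha0 hw.integrable hl x)]
    simp only [sub_mul]

/-- The strong maximum principle for functions with the mean value property. -/
theorem HasMeanValue.eq_of_isMax (hg : IsMeanGenerator a g) (ha : (n : ℝ) < a) (hn : n ≠ 0)
    (hw : HasMeanValue a g w) {x₀ : 𝔼} (hx₀ : ∀ x, w x ≤ w x₀) (x : 𝔼) : w x = w x₀ := by
  have h := hg.ae_eq_of_le_kernelMean ha hn hw.integrable (.of_forall hx₀)
    (x₀ := x₀) fun l hl => (hw.mean_eq l hl x₀).ge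
  exact congrFun (Continuous.ae_eq_iff_eq volume hw.continuous continuous_const |>.1 h) x

/-- A positive value together with decay at infinity would force a maximum, hence a positive
constant, contradicting the decay. -/
theorem HasMeanValue.nonpos_of_tendsto (hg : IsMeanGenerator a g) (ha : (n : ℝ) < a) (hn : n ≠ 0)
    (hw : HasMeanValue a g w) (h0 : Tendsto w (cocompact 𝔼) (𝓝 0)) (x : 𝔼) : w x ≤ 0 := by
  have : NeZero n := ⟨hn⟩
  by_contra! hx
  obtain ⟨x₀, hx₀⟩ := hw.continuous.exists_forall_ge' x
    ((h0.eventually_lt_const hx).mono fun y hy => hy.le)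
  have hconst := hw.eq_of_isMax hg ha hn hx₀
  have h1 : Tendsto w (cocompact 𝔼) (𝓝 (w x₀)) :=
    tendsto_const_nhds.congr fun y => (hconst y).symm
  have h2 := tendsto_nhds_unique h0 h1
  linarith [hx₀ x]

theorem HasMeanValue.eq_zero_of_tendsto (hg : IsMeanGenerator a g) (ha : (n : ℝ) < a)
    (hn : n ≠ 0) (hw : HasMeanValue a g w) (h0 : Tendsto w (cocompact 𝔼) (𝓝 0)) (x : 𝔼) :
    w x = 0 := by
  refine le_antisymm (hw.nonpos_of_tendsto hg ha hn h0 x) ?_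
  have := hw.neg.nonpos_of_tendsto hg ha hn (by simpa using h0.neg) x
  linarith

/-- A weighted integrable function annihilated by the dilates of `g` agrees a.e. with a continuous
function that has the mean value property. -/
theorem exists_hasMeanValue_of_integral_eq_zero (hg : IsMeanGenerator a g) (ha : (n : ℝ) < a)
    (hn : n ≠ 0) {f : 𝔼 → ℝ} (hf : Integrable fun x => f x * weight a x)
    (h0 : ∀ x, ∀ σ : ℝ, 0 < σ → ∫ y, f y * g (σ • (x - y)) = 0) :
    ∃ w, HasMeanValue a g w ∧ f =ᵐ[volume] w := by
  have ha0 : 0 ≤ a := (Nat.cast_nonneg n).trans ha.le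
  have hm := hg.integral_pos ha hn
  set m := ∫ z, segmentMean g z with hm_def
  have hnf : Integrable fun x => -f x * weight a x := by
    simpa only [neg_mul] using hf.fun_neg
  have key : ∀ l : ℝ, 0 < l → ∀ᵐ x, f x = kernelMean g f l x / m := by
    intro l hl
    filter_upwards [hg.ae_le_kernelMean ha hn hf (fun x σ hσ => (h0 x σ hσ).le) hl,
      hg.ae_le_kernelMean ha hn hnf (fun x σ hσ => by simp [integral_neg, h0 x σ hσ]) hl]
      with x h1 h2
    have h3 : kernelMean g (fun x => -f x) l x = -kernelMean g f l x := by
      simp only [kernelMean, neg_mul, integral_neg]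
    rw [h3] at h2
    rw [eq_div_iff hm.ne', mul_comm]
    linarith
  have hc : ∀ l : ℝ, 0 < l → Continuous fun x => kernelMean g f l x / m := fun l hl =>
    (hg.continuous_kernelMean ha0 hf hl).div_const m
  refine ⟨fun x => kernelMean g f 1 x / m, ⟨hc 1 one_pos, ?_, fun l hl x => ?_⟩, key 1 one_pos⟩
  · refine hf.congr ?_
    filter_upwards [key 1 one_pos] with x hx
    rw [hx]
  -- Normalized means at all scales agree a.e. with `f`, hence with one another, and by continuity
  -- they agree everywhere.
  · have h1 : (fun x => kernelMean g f l x / m) = fun x => kernelMean g f 1 x / m := by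
      refine (Continuous.ae_eq_iff_eq volume (hc l hl) (hc 1 one_pos)).1 ?_
      filter_upwards [key 1 one_pos, key l hl] with x hx1 hx2
      rw [← hx1, ← hx2]
    have h2 : kernelMean g (fun x => kernelMean g f 1 x / m) l x = kernelMean g f l x := by
      refine integral_congr_ae ?_
      filter_upwards [key 1 one_pos] with y hy
      rw [hy]
    rw [h2, ← congrFun h1 x, mul_div_cancel₀ _ hm.ne']

end MeanValue

/-! ### From extended-valued functions to the kernel argument -/

section Admissible

variable {s : ℝ} {u : EuclideanSpace ℝ (Fin n) → EReal}

theorem ofReal_weight_eq (x : 𝔼) : ENNReal.ofReal (weight ((n : ℝ) + 2 * s) x) =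
    (ENNReal.ofReal ((1 + ‖x‖ ^ 2) ^ (((n : ℝ) + 2 * s) / 2)))⁻¹ := by
  rw [← ENNReal.ofReal_inv_of_pos (by positivity), weight, neg_div,
    Real.rpow_neg (by positivity)]

theorem integrable_toReal_mul_weight (hu : Measurable u) (hi : WeightedIntegrable s u) :
    Integrable fun x => (u x).toReal * weight ((n : ℝ) + 2 * s) x := by
  refine ⟨(hu.ereal_toReal.mul continuous_weight.measurable).aestronglyMeasurable,
    lt_of_le_of_lt (lintegral_mono fun x => ?_) hi⟩
  rw [enorm_mul, div_eq_mul_inv, ← ofReal_weight_eq, Real.enorm_of_nonneg (weight_pos x).le]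
  gcongr
  induction u x with
  | bot => simp
  | top => simp
  | coe r => simp [EReal.abs_def, Real.enorm_eq_ofReal_abs]

theorem ae_eq_coe_toReal (hu : Measurable u) (hi : WeightedIntegrable s u) :
    ∀ᵐ x, u x = ((u x).toReal : EReal) := by
  have habs : Measurable fun x => (u x).abs := by
    have h : (fun x => (u x).abs) = fun x =>
        if u x = ⊥ ∨ u x = ⊤ then ⊤ else ENNReal.ofReal |(u x).toReal| := by
      ext x
      induction u x with
      | bot => simp
      | top => simp
      | coe r => simp [EReal.abs_def]
    rw [h]
    exact Measurable.ite ((hu (measurableSet_singleton _)).union (hu (measurableSet_singleton _)))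
      measurable_const (hu.ereal_toReal.abs.ennreal_ofReal)
  have hm : Measurable fun x => (u x).abs /
      ENNReal.ofReal ((1 + ‖x‖ ^ 2) ^ (((n : ℝ) + 2 * s) / 2)) :=
    habs.div (by fun_prop)
  filter_upwards [ae_lt_top hm hi.ne] with x hx
  refine (EReal.coe_toReal ?_ ?_).symm <;>
  · intro h
    simp [h, ENNReal.top_div] at hx

/-- Neighbourhoods have positive measure. Without this, the essential upper limit of a continuous
function need not be its value. -/
theorem neBot_nhds_inf_ae (x : 𝔼) : (𝓝 x ⊓ ae (volume : Measure 𝔼)).NeBot := by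
  rw [inf_neBot_iff]
  intro s hs t ht
  have h1 : volume (s ∩ t) ≠ 0 := by
    rw [Set.inter_comm, Measure.measure_inter_eq_of_ae ht]
    exact (Measure.measure_pos_of_mem_nhds volume hs).ne'
  exact nonempty_of_measure_ne_zero h1

theorem limsup_coe_eq {v : 𝔼 → ℝ} (hv : Continuous v) (x : 𝔼) :
    limsup (fun y => (v y : EReal)) (𝓝 x ⊓ ae volume) = v x := by
  have := neBot_nhds_inf_ae x
  exact (((continuous_coe_real_ereal.comp hv).tendsto x).mono_left inf_le_left).limsup_eq

/-- The clause `precise` upgrades an a.e. bound to every point, which is what allows evaluation at a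
maximum point. -/
theorem IsAdmissible.le_of_ae_le (hu : IsAdmissible s u) {v : 𝔼 → ℝ} (hv : Continuous v)
    (h : ∀ᵐ y, u y ≤ v y) (x : 𝔼) : u x ≤ v x := by
  rw [hu.precise x, ← limsup_coe_eq hv x]
  exact limsup_le_limsup (h.filter_mono inf_le_right)

theorem IsAdmissible.eq_of_ae_eq (hu : IsAdmissible s u) {v : 𝔼 → ℝ} (hv : Continuous v)
    (h : ∀ᵐ y, u y = v y) (x : 𝔼) : u x = v x := by
  rw [hu.precise x, ← limsup_coe_eq hv x]
  exact limsup_congr (h.filter_mono inf_le_right)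

theorem fracLaplacianDistrib_bump (hn : n ≠ 0) (hs₀ : 0 < s) (hs₁ : s ≤ 1)
    (u : 𝔼 → EReal) {σ : ℝ} (hσ : 0 < σ) (x : 𝔼) :
    fracLaplacianDistrib s u (fun y => bump (σ • (x - y))) =
      σ ^ (2 * s) * ∫ y, (u y).toReal * fracLaplacian s bump (σ • (x - y)) := by
  rw [fracLaplacianDistrib, ← integral_const_mul]
  congr 1; ext y
  rw [fracLaplacian_bump_comp_smul_sub hn hs₀ hs₁ hσ]
  ring

theorem IsSSubharmonic.integral_mul_le (hn : n ≠ 0) (hs₀ : 0 < s) (hs₁ : s ≤ 1)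
    (hu : IsSSubharmonic s u) (x : 𝔼) (σ : ℝ) (hσ : 0 < σ) :
    ∫ y, (u y).toReal * fracLaplacian s bump (σ • (x - y)) ≤ 0 := by
  have h := hu.2 _ (isTestFunction_bump.comp_smul_sub hσ x) fun y => bump_nonneg _
  rw [fracLaplacianDistrib_bump hn hs₀ hs₁ u hσ] at h
  have hp : 0 < σ ^ (2 * s) := by positivity
  exact nonpos_of_mul_nonpos_right (neg_nonneg.1 h) hp

theorem IsSHarmonic.integral_mul_eq_zero (hn : n ≠ 0) (hs₀ : 0 < s) (hs₁ : s ≤ 1)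
    (hu : IsSHarmonic s u) (x : 𝔼) (σ : ℝ) (hσ : 0 < σ) :
    ∫ y, (u y).toReal * fracLaplacian s bump (σ • (x - y)) = 0 := by
  refine le_antisymm (hu.1.integral_mul_le hn hs₀ hs₁ x σ hσ) ?_
  have h := hu.2 _ (isTestFunction_bump.comp_smul_sub hσ x) fun y => bump_nonneg _
  rw [fracLaplacianDistrib_bump hn hs₀ hs₁ u hσ] at h
  have hp : 0 < σ ^ (2 * s) := by positivity
  exact nonneg_of_mul_nonneg_right (neg_nonpos.1 h) hp

/-- An `s`-harmonic function is real valued and continuous and has the mean value property. -/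
theorem IsSHarmonic.exists_hasMeanValue (hn : n ≠ 0) (hs₀ : 0 < s) (hs₁ : s ≤ 1)
    (hu : IsSHarmonic s u) : ∃ w : 𝔼 → ℝ,
      HasMeanValue ((n : ℝ) + 2 * s) (fracLaplacian s bump) w ∧ ∀ x, u x = w x := by
  have hadm := hu.1.1
  have hmeas := hadm.usc.measurable
  obtain ⟨w, hw, he⟩ := exists_hasMeanValue_of_integral_eq_zero
    (isMeanGenerator_fracLaplacian_bump hn hs₀ hs₁) (by linarith) hn
    (integrable_toReal_mul_weight hmeas hadm.integrable)
    (hu.integral_mul_eq_zero hn hs₀ hs₁)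
  refine ⟨w, hw, hadm.eq_of_ae_eq hw.continuous ?_⟩
  filter_upwards [he, ae_eq_coe_toReal hmeas hadm.integrable] with x h1 h2
  rw [h2, h1]

/-- The strong maximum principle for `s`-subharmonic functions. -/
theorem IsSSubharmonic.isConst_of_attainsMax (hn : n ≠ 0) (hs₀ : 0 < s) (hs₁ : s ≤ 1)
    (hu : IsSSubharmonic s u) (hmax : AttainsMax u) : IsConst u := by
  obtain ⟨x₀, hx₀⟩ := hmax
  have hadm := hu.1
  have hmeas := hadm.usc.measurable
  rcases eq_or_ne (u x₀) ⊥ with hbot | hbot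
  -- A maximum equal to `⊥` makes `u` identically `⊥`, which `IsConst` admits.
  · exact ⟨⊥, fun x => le_bot_iff.1 (hbot ▸ hx₀ x)⟩
  set M := (u x₀).toReal with hM
  have hMe : u x₀ = M := (EReal.coe_toReal (hadm.lt_top x₀).ne hbot).symm
  have hg := isMeanGenerator_fracLaplacian_bump (n := n) hn hs₀ hs₁
  have ha : (n : ℝ) < n + 2 * s := by linarith
  have ha0 : (0 : ℝ) ≤ n + 2 * s := by positivity
  have hi := integrable_toReal_mul_weight hmeas hadm.integrable
  have hae := ae_eq_coe_toReal hmeas hadm.integrable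
  have hm := hg.integral_pos ha hn
  have hle : ∀ᵐ x, (u x).toReal ≤ M := by
    filter_upwards [hae] with x hx
    rw [← EReal.coe_le_coe_iff, ← hx, ← hMe]
    exact hx₀ x
  have hconst := hg.ae_eq_of_le_kernelMean ha hn hi hle (x₀ := x₀) fun l hl => by
    have h1 := hadm.le_of_ae_le (v := fun x => kernelMean (fracLaplacian s bump)
        (fun y => (u y).toReal) l x / ∫ z : 𝔼, segmentMean (fracLaplacian s bump) z)
      ((hg.continuous_kernelMean ha0 hi hl).div_const _) (by
        filter_upwards [hae, hg.ae_le_kernelMean ha hn hi (hu.integral_mul_le hn hs₀ hs₁) hl]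
          with x h1 h2
        rw [h1, EReal.coe_le_coe_iff, le_div_iff₀ hm, mul_comm]
        exact h2) x₀
    rw [hMe, EReal.coe_le_coe_iff, le_div_iff₀ hm, mul_comm] at h1
    exact h1
  refine ⟨M, hadm.eq_of_ae_eq continuous_const ?_⟩
  filter_upwards [hae, hconst] with x h1 h2
  rw [h1, h2]

theorem IsSHarmonic.isConst_of_attainsMin (hn : n ≠ 0) (hs₀ : 0 < s) (hs₁ : s ≤ 1)
    (hu : IsSHarmonic s u) (hmin : AttainsMin u) : IsConst u := by
  obtain ⟨w, hw, he⟩ := hu.exists_hasMeanValue hn hs₀ hs₁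
  obtain ⟨x₀, hx₀⟩ := hmin
  have h := hw.neg.eq_of_isMax (isMeanGenerator_fracLaplacian_bump hn hs₀ hs₁) (by linarith) hn
    (x₀ := x₀) fun x => by
      have := hx₀ x
      rw [he, he, EReal.coe_le_coe_iff] at this
      exact neg_le_neg this
  exact ⟨w x₀, fun x => by rw [he, neg_injective (h x)]⟩

end Admissible

end FracSub

end

/-! ### The maximum principle and its corollaries -/

theorem mainTheorem9 (n : ℕ) (hn : 2 ≤ n) (s : ℝ) (hs₀ : 0 < s) (hs₁ : s ≤ 1) :
    -- the maximum principle
    (∀ u : EuclideanSpace ℝ (Fin n) → EReal,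
      FracSub.IsRadial u → FracSub.IsSSubharmonic s u →
        FracSub.IsConst u ∨ ¬ FracSub.AttainsMax u) ∧
    -- radial s-harmonic functions attain neither a maximum nor a minimum, unless constant
    (∀ u : EuclideanSpace ℝ (Fin n) → EReal,
      FracSub.IsRadial u → FracSub.IsSHarmonic s u →
        FracSub.IsConst u ∨ (¬ FracSub.AttainsMax u ∧ ¬ FracSub.AttainsMin u)) ∧
    -- ordered radial s-harmonic functions do not touch, unless they coincide
    (∀ u₁ u₂ : EuclideanSpace ℝ (Fin n) → EReal,
      FracSub.IsRadial u₁ → FracSub.IsRadial u₂ →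
      FracSub.IsSHarmonic s u₁ → FracSub.IsSHarmonic s u₂ →
      (∀ x, u₂ x ≤ u₁ x) →
        (∀ x, u₂ x < u₁ x) ∨ (∀ x, u₁ x = u₂ x)) ∧
    -- a continuous radial s-harmonic function that vanishes at infinity is zero
    (∀ u : EuclideanSpace ℝ (Fin n) → EReal,
      FracSub.IsRadial u → Continuous u → FracSub.IsSHarmonic s u →
      Tendsto u (cocompact (EuclideanSpace ℝ (Fin n))) (𝓝 0) →
        ∀ x, u x = 0) ∧
    -- uniqueness
    (∀ u₁ u₂ : EuclideanSpace ℝ (Fin n) → ℝ,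
      FracSub.IsRadial u₁ → FracSub.IsRadial u₂ →
      Continuous u₁ → Continuous u₂ →
      FracSub.WeightedIntegrable s (fun x => (u₁ x : EReal)) →
      FracSub.WeightedIntegrable s (fun x => (u₂ x : EReal)) →
      (∀ h : EuclideanSpace ℝ (Fin n) → ℝ, FracSub.IsTestFunction h →
        FracSub.fracLaplacianDistrib s (fun x => (u₁ x : EReal)) h =
          FracSub.fracLaplacianDistrib s (fun x => (u₂ x : EReal)) h) →
      Tendsto (fun x => u₁ x - u₂ x) (cocompact (EuclideanSpace ℝ (Fin n))) (𝓝 0) →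
        ∀ x, u₁ x = u₂ x) := by
  have hn0 : n ≠ 0 := by omega
  have ha : (n : ℝ) < n + 2 * s := by linarith
  have hg := FracSub.isMeanGenerator_fracLaplacian_bump (n := n) hn0 hs₀ hs₁
  refine ⟨fun u _ hu => ?_, fun u _ hu => ?_, fun u₁ u₂ _ _ h₁ h₂ hle => ?_,
    fun u _ _ hu h0 x => ?_, fun u₁ u₂ _ _ hc₁ hc₂ hi₁ hi₂ heq h0 x => ?_⟩
  · by_cases h : FracSub.AttainsMax u
    · exact .inl (hu.isConst_of_attainsMax hn0 hs₀ hs₁ h)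
    · exact .inr h
  · by_cases h : FracSub.AttainsMax u
    · exact .inl (hu.1.isConst_of_attainsMax hn0 hs₀ hs₁ h)
    by_cases h' : FracSub.AttainsMin u
    · exact .inl (hu.isConst_of_attainsMin hn0 hs₀ hs₁ h')
    · exact .inr ⟨h, h'⟩
  · obtain ⟨w₁, hw₁, he₁⟩ := h₁.exists_hasMeanValue hn0 hs₀ hs₁
    obtain ⟨w₂, hw₂, he₂⟩ := h₂.exists_hasMeanValue hn0 hs₀ hs₁
    simp only [he₁, he₂, EReal.coe_le_coe_iff, EReal.coe_lt_coe_iff, EReal.coe_eq_coe_iff]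
      at hle ⊢
    by_cases h : ∀ x, w₂ x < w₁ x
    · exact .inl h
    · push Not at h
      obtain ⟨x₀, hx₀⟩ := h
      -- At a touching point the nonpositive difference `w₂ - w₁` attains its maximum 0, so it is
      -- constant.
      have h1 := (hw₂.sub hg ha hw₁).eq_of_isMax hg ha hn0 (x₀ := x₀)
        fun x => by linarith [hle x]
      refine .inr fun x => ?_
      linarith [h1 x, hle x, hle x₀]
  · obtain ⟨w, hw, he⟩ := hu.exists_hasMeanValue hn0 hs₀ hs₁
    have h1 : Tendsto w (cocompact (EuclideanSpace ℝ (Fin n))) (𝓝 0) := by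
      rw [← EReal.tendsto_coe]
      exact h0.congr he
    rw [he, hw.eq_zero_of_tendsto hg ha hn0 h1 x, EReal.coe_zero]
  · have i₁ := FracSub.integrable_toReal_mul_weight
      (continuous_coe_real_ereal.comp hc₁).measurable hi₁
    have i₂ := FracSub.integrable_toReal_mul_weight
      (continuous_coe_real_ereal.comp hc₂).measurable hi₂
    simp only [Function.comp_apply, EReal.toReal_coe] at i₁ i₂
    have hi : Integrable fun x => (u₁ x - u₂ x) * FracSub.weight ((n : ℝ) + 2 * s) x := by
      simp only [sub_mul]
      exact Integrable.sub i₁ i₂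
    -- The kernel argument applies directly to the real function `u₁ - u₂`: it needs only weighted
    -- integrability and the equation tested on dilated bumps.
    obtain ⟨w, hw, he⟩ := FracSub.exists_hasMeanValue_of_integral_eq_zero hg ha hn0 hi
      fun x σ hσ => by
        have h := heq _ (FracSub.isTestFunction_bump.comp_smul_sub hσ x)
        rw [FracSub.fracLaplacianDistrib_bump hn0 hs₀ hs₁ _ hσ,
          FracSub.fracLaplacianDistrib_bump hn0 hs₀ hs₁ _ hσ] at h
        simp only [EReal.toReal_coe] at h
        have h2 := mul_left_cancel₀ (by positivity : σ ^ (2 * s) ≠ 0) h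
        simp only [sub_mul]
        rw [integral_sub, h2, sub_self]
        · exact FracSub.integrable_mul_comp_smul_sub (by positivity) hg.continuous hg.abs_le i₁ hσ x
        · exact FracSub.integrable_mul_comp_smul_sub (by positivity) hg.continuous hg.abs_le i₂ hσ x
    have hew := (Continuous.ae_eq_iff_eq volume (hc₁.sub hc₂) hw.continuous).1 he
    have h1 := hw.eq_zero_of_tendsto hg ha hn0 (hew ▸ h0) x
    rw [← hew] at h1
    exact sub_eq_zero.1 h1
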